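/- Let $(H,Q)$ be a complex Hilbert space with a (possibly unbounded) self-adjoint operator. For a self-adjoint operator write $\sigma(Q)$ for its spectrum and $\sigma_e(Q)$ for its essential spectrum, the set of $\lambda\in\mathbb C$ such that $(Q-\lambda I)S\neq I+K$ for every bounded operator $S$ and every compact operator $K$. Let $\mathcal K$ be the class of all pairs $(H',Q')$, with $H'$ a complex Hilbert space and $Q'$ a self-adjoint operator on $H'$, such that $\sigma(Q')=\sigma(Q)$, $\sigma_e(Q')=\sigma_e(Q)$ and $\dim\ker(Q'-\lambda)=\dim\ker(Q-\lambda)$ for all $\lambda\in\sigma(Q)\setminus\sigma_e(Q)$. For members of $\mathcal K$ write $(H_1,Q_1)\prec(H_2,Q_2)$ if $H_1$ is a Hilbert subspace of $H_2$ and $Q_1\subseteq Q_2$. Let $\Gamma_Q(v,w)$ denote the distance of $(v,w)$ to the graph of $Q$ in $H\times H$. A $\mathcal K$-embedding $f:(H_1,Q_1)\to(H_2,Q_2)$ is a linear isometry with $\Gamma_{Q_2}(fv,fw)=\Gamma_{Q_1}(v,w)$ for all $v,w\in H_1$ whose image, with the transported operator, is $\prec(H_2,Q_2)$. For $(H',Q')\in\mathcal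 K$ and $G\subseteq H'$ let $H_G$ be the closed linear span of the vectors $f(Q')x$, with $x\in G$ and $f$ a bounded Borel function on $\mathbb R$ (bounded Borel functional calculus), let $Q_G$ be the restriction of $Q'$ to $H_G$, and let $P_G$ and $P_{G^\perp}$ be the orthogonal projections of $H'$ onto $H_G$ and $H_G^\perp$. For $x\in H'$ let $\mu_x$ be its spectral measure, $\mu_x(\Omega)=\langle\chi_\Omega(Q')x\mid x\rangle$ for Borel sets $\Omega\subseteq\mathbb R$. Let $(H_1,Q_1),(H_2,Q_2)\in\mathcal K$, $v\in H_1$, $w\in H_2$, and let $G\subseteq H_1\cap H_2$ be such that $(H_G,Q_G)\in\mathcal K$ is a common substructure, $(H_G,Q_G)\prec(H_1,Q_1)$ and $(H_G,Q_G)\prec(H_2,Q_2)$. Then $v$ and $w$ have the same Galois type over $G$, that is, there are $(H_3,Q_3)\in\mathcal K$ and $\mathcal K$-embeddings $f:(H_1,Q_1)\to(H_3,Q_3)$ and $g:(H_2,Q_2)\to(H_3,Q_3)$ with $f(v)=g(w)$ and $f(x)=g(x)=x$ for all $x\in G$ (the elements of $G$ being identified with their common image in $H_3$), if and only if \[P_Gv=P_Gw\quad\text{and}\quad\mu_{P_{G^\perp}v}=\mu_{P_{G^\perp}w}.\]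 -/

import Mathlib

open Filter Topology MeasureTheory
open scoped ENNReal InnerProductSpace

universe u

noncomputable section

/-! ### Hilbert spaces with a self-adjoint operator -/

/-- A Hilbert space operator structure: a complex Hilbert space `H` together with a (possibly
unbounded) self-adjoint operator `Q` on `H`. In Mathlib `IsSelfAdjoint Q` for a partially defined
operator says `Q = Q†`; it implies that the domain of `Q` is dense
(`IsSelfAdjoint.dense_domain`) and that `Q` is closed (`IsSelfAdjoint.isClosed`). -/
structure HilbertOperator where
  /-- the underlying Hilbert space -/
  carrier : Type u
  [normed : NormedAddCommGroup carrier]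
  [innerProduct : InnerProductSpace ℂ carrier]
  [complete : CompleteSpace carrier]
  /-- the self-adjoint operator -/
  Q : carrier →ₗ.[ℂ] carrier
  selfAdjoint : IsSelfAdjoint Q

attribute [instance] HilbertOperator.normed HilbertOperator.innerProduct HilbertOperator.complete

instance : CoeSort HilbertOperator.{u} (Type u) := ⟨HilbertOperator.carrier⟩

namespace HilbertOperator

/-- `M.Γ v w` is the distance in the Hilbert space `H × H` of `(v, w)` to the graph of `Q`. -/
def Γ (M : HilbertOperator.{u}) (v w : M) : ℝ :=
  Metric.infDist (WithLp.toLp 2 (v, w)) (WithLp.toLp 2 '' (M.Q.graph : Set (M × M)))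

/-! ### Spectrum, essential spectrum, spectral equivalence -/

/-- The values `z` for which `Q - z` is not one-to-one. -/
def pointSpectrum (M : HilbertOperator.{u}) : Set ℂ :=
  {z | ¬ Function.Injective (fun v : M.Q.domain => M.Q v - z • (v : M))}

/-- The values `z` for which `Q - z` is one-to-one and `(Q - z)⁻¹` is densely defined but not
bounded. -/
def continuousSpectrum (M : HilbertOperator.{u}) : Set ℂ :=
  {z | Function.Injective (fun v : M.Q.domain => M.Q v - z • (v : M)) ∧
    DenseRange (fun v : M.Q.domain => M.Q v - z • (v : M)) ∧
    ¬ ∃ C : ℝ, ∀ v : M.Q.domain, ‖(v : M)‖ ≤ C * ‖M.Q v - z • (v : M)‖}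

/-- The values `z` for which the range of `Q - z` is not dense. -/
def residualSpectrum (M : HilbertOperator.{u}) : Set ℂ :=
  {z | ¬ DenseRange (fun v : M.Q.domain => M.Q v - z • (v : M))}

/-- The spectrum `σ(Q)`. -/
def spectrum (M : HilbertOperator.{u}) : Set ℂ :=
  M.pointSpectrum ∪ M.continuousSpectrum ∪ M.residualSpectrum

/-- The essential spectrum `σₑ(Q)`: the values `z` such that `(Q - z) S ≠ 1 + K` for every bounded
operator `S` and every compact operator `K`. The equality of `(Q - z) S` with the everywhere
defined operator `1 + K` includes that `S` takes its values in the domain of `Q`. -/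
def essentialSpectrum (M : HilbertOperator.{u}) : Set ℂ :=
  {z | ∀ S K : M →L[ℂ] M, IsCompactOperator K →
    ¬ ∀ v : M, ∃ h : S v ∈ M.Q.domain, M.Q ⟨S v, h⟩ - z • S v = v + K v}

/-- The eigenspace `{x ∈ D(Q) | Q x = z x}`. -/
def eigenspace (M : HilbertOperator.{u}) (z : ℂ) : Submodule ℂ M :=
  M.Q.graph.comap (LinearMap.id.prod (z • LinearMap.id))

/-- Spectral equivalence `Q₁ ∼_σ Q₂`. -/
def SpectrallyEquivalent (M₁ M₂ : HilbertOperator.{u}) : Prop :=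
  M₁.spectrum = M₂.spectrum ∧
  M₁.essentialSpectrum = M₂.essentialSpectrum ∧
  ∀ z ∈ M₁.spectrum \ M₁.essentialSpectrum,
    Module.rank ℂ (M₁.eigenspace z) = Module.rank ℂ (M₂.eigenspace z)

/-! ### The class and its embeddings -/

/-- The class `𝒦_{(H, Γ_Q)}` of all structures that are spectrally equivalent to `(H, Γ_Q)`. -/
def structureClass (H : HilbertOperator.{u}) : Set HilbertOperator.{u} :=
  {M | SpectrallyEquivalent M H}

/-- The relation `≺` (`H₁ ⊆ H₂` and `Q₁ ⊆ Q₂`) between two members of the class, where the inclusion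
of Hilbert spaces is written as a linear isometry `j`. -/
def IsKSubstructure {M₁ M₂ : HilbertOperator.{u}} (j : M₁ →ₗᵢ[ℂ] M₂) : Prop :=
  ∀ x y : M₁, (x, y) ∈ M₁.Q.graph → (j x, j y) ∈ M₂.Q.graph

/-- A `𝒦`-embedding: an embedding of metric structures (it preserves the linear structure, the norm
and the function `Γ`) whose image is a `𝒦`-substructure. -/
def IsKEmbedding {M₁ M₂ : HilbertOperator.{u}} (f : M₁ →ₗᵢ[ℂ] M₂) : Prop :=
  (∀ v w : M₁, M₂.Γ (f v) (f w) = M₁.Γ v w) ∧ IsKSubstructure f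

/-- Equality of the Galois types of `v` in `M₁` and of `w` in `M₂` over a common set `A` of
parameters, in the class of `H`: there are a structure `N` in the class and `𝒦`-embeddings `f`, `g`
of `M₁`, `M₂` into `N` which agree on `A` and satisfy `f v = g w`. The set `A` is common to `M₁` and
`M₂` through the maps `a₁`, `a₂`; since the class is closed under isomorphism, `A` may be identified
with its common image in `N`, and then `f` and `g` are the identity on `A`. -/
def SameGaloisType (H M₁ M₂ : HilbertOperator.{u}) {A : Type u} (a₁ : A → M₁) (a₂ : A → M₂)
    (v : M₁) (w : M₂) : Prop :=
  ∃ N ∈ H.structureClass, ∃ (f : M₁ →ₗᵢ[ℂ] N) (g : M₂ →ₗᵢ[ℂ] N),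
    IsKEmbedding f ∧ IsKEmbedding g ∧ f v = g w ∧ ∀ a : A, f (a₁ a) = g (a₂ a)

end HilbertOperator

/-! ### Bounded Borel functional calculus -/

/-- The `*`-algebra of bounded Borel functions `ℝ → ℂ`. -/
def BoundedBorel : StarSubalgebra ℂ (ℝ → ℂ) where
  carrier := {f | Measurable f ∧ ∃ C : ℝ, ∀ x, ‖f x‖ ≤ C}
  mul_mem' := by
    rintro f g ⟨hf, C, hC⟩ ⟨hg, D, hD⟩
    refine ⟨hf.mul hg, C * D, fun x => ?_⟩
    rw [Pi.mul_apply, norm_mul]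
    exact mul_le_mul (hC x) (hD x) (norm_nonneg _) ((norm_nonneg _).trans (hC x))
  add_mem' := by
    rintro f g ⟨hf, C, hC⟩ ⟨hg, D, hD⟩
    exact ⟨hf.add hg, C + D, fun x => (norm_add_le _ _).trans (add_le_add (hC x) (hD x))⟩
  algebraMap_mem' r := ⟨measurable_const, ‖r‖, fun _ => le_rfl⟩
  star_mem' := by
    rintro f ⟨hf, C, hC⟩
    exact ⟨Complex.continuous_conj.measurable.comp hf, C, fun x => by simpa using hC x⟩

/-- The characteristic function `χ_Ω` of a Borel set. -/
def BoundedBorel.indicator (Ω : Set ℝ) (hΩ : MeasurableSet Ω) : BoundedBorel :=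
  ⟨Ω.indicator 1, measurable_one.indicator hΩ, 1, fun x => by
    by_cases hx : x ∈ Ω <;> simp [hx]⟩

/-- A bounded Borel functional calculus for `Q`: a `*`-homomorphism from the bounded Borel functions
to the bounded operators on `H` with the following two properties. By the spectral theorem every
self-adjoint `Q` has exactly one. -/
structure BorelCalculus (M : HilbertOperator.{u}) where
  /-- the `*`-homomorphism -/
  hom : BoundedBorel →⋆ₐ[ℂ] (M →L[ℂ] M)
  /-- if `hₙ(x) → x` and `|hₙ(x)| ≤ |x|`, then `hₙ(Q) v → Q v` for every `v` in the domain of `Q` -/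
  tendsto_operator : ∀ h : ℕ → BoundedBorel,
    (∀ x : ℝ, Tendsto (fun n => (h n : ℝ → ℂ) x) atTop (𝓝 (x : ℂ))) →
    (∀ n x, ‖(h n : ℝ → ℂ) x‖ ≤ |x|) →
    ∀ v : M.Q.domain, Tendsto (fun n => hom (h n) v) atTop (𝓝 (M.Q v))
  /-- if `hₙ → h` pointwise and boundedly, then `hₙ(Q) → h(Q)` strongly -/
  tendsto_strong : ∀ (h : ℕ → BoundedBorel) (k : BoundedBorel),
    (∀ x : ℝ, Tendsto (fun n => (h n : ℝ → ℂ) x) atTop (𝓝 ((k : ℝ → ℂ) x))) →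
    (∃ C : ℝ, ∀ n x, ‖(h n : ℝ → ℂ) x‖ ≤ C) →
    ∀ v : M, Tendsto (fun n => hom (h n) v) atTop (𝓝 (hom k v))

namespace HilbertOperator

open Classical in
/-- The bounded operator `f(Q)` for a bounded Borel function `f`, given by the functional calculus
of `Q` (which exists and is unique; the value `0` in the other case is never taken). -/
def applyBorel (M : HilbertOperator.{u}) (f : BoundedBorel) : M →L[ℂ] M :=
  if h : Nonempty (BorelCalculus M) then h.some.hom f else 0

/-- The spectral projection `E_Ω = χ_Ω(Q)`. -/
def spectralProjection (M : HilbertOperator.{u}) (Ω : Set ℝ) (hΩ : MeasurableSet Ω) : M →L[ℂ] M :=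
  M.applyBorel (BoundedBorel.indicator Ω hΩ)

theorem spectralProjection_empty (M : HilbertOperator.{u}) :
    M.spectralProjection ∅ MeasurableSet.empty = 0 := by
  have h0 : BoundedBorel.indicator ∅ MeasurableSet.empty = 0 := by
    apply Subtype.ext
    funext x
    simp [BoundedBorel.indicator]
  unfold spectralProjection applyBorel
  split_ifs with h
  · rw [h0, map_zero]
  · rfl

theorem re_inner_spectralProjection_nonneg (M : HilbertOperator.{u}) (Ω : Set ℝ)
    (hΩ : MeasurableSet Ω) (v : M) : 0 ≤ (⟪v, M.spectralProjection Ω hΩ v⟫_ℂ).re := by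
  unfold spectralProjection applyBorel
  split_ifs with h
  · have hχ : BoundedBorel.indicator Ω hΩ =
        star (BoundedBorel.indicator Ω hΩ) * BoundedBorel.indicator Ω hΩ := by
      apply Subtype.ext
      funext x
      by_cases hx : x ∈ Ω <;> simp [BoundedBorel.indicator, hx]
    rw [hχ, map_mul, map_star, mul_apply_eq_comp, ContinuousLinearMap.star_eq_adjoint,
      ContinuousLinearMap.adjoint_inner_right]
    exact inner_self_nonneg (𝕜 := ℂ)
  · simp

theorem tendsto_sum_spectralProjection (M : HilbertOperator.{u}) (s : ℕ → Set ℝ)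
    (hs : ∀ i, MeasurableSet (s i)) (hd : Pairwise (Function.onFun Disjoint s)) (v : M) :
    Tendsto (fun n => ∑ i ∈ Finset.range n, M.spectralProjection (s i) (hs i) v) atTop
      (𝓝 (M.spectralProjection (⋃ i, s i) (MeasurableSet.iUnion hs) v)) := by
  unfold spectralProjection applyBorel
  split_ifs with h
  · have hcoe : ∀ n : ℕ,
        ((∑ i ∈ Finset.range n, BoundedBorel.indicator (s i) (hs i) : BoundedBorel) : ℝ → ℂ) =
          (⋃ i ∈ Finset.range n, s i).indicator 1 := by
      intro n
      rw [Finset.indicator_biUnion _ _ fun i _ j _ hij => hd hij]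
      funext x
      rw [AddSubmonoidClass.coe_finsetSum, Finset.sum_apply]
      rfl
    have hlim := h.some.tendsto_strong
      (fun n => ∑ i ∈ Finset.range n, BoundedBorel.indicator (s i) (hs i))
      (BoundedBorel.indicator (⋃ i, s i) (MeasurableSet.iUnion hs))
      (fun x => by
        simp only [hcoe]
        exact ((tendsto_indicator_biUnion_finset s (1 : ℝ → ℂ) x).comp
          tendsto_finset_range).mono_right (pure_le_nhds _))
      ⟨1, fun n x => by
        rw [hcoe]
        by_cases hx : x ∈ ⋃ i ∈ Finset.range n, s i
        · rw [Set.indicator_of_mem hx]; simp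
        · rw [Set.indicator_of_notMem hx]; simp⟩ v
    simpa only [map_sum, sum_apply] using hlim
  · simp

/-- The spectral measure `μ_v` defined by `v`: the Borel measure `Ω ↦ ⟨χ_Ω(Q) v | v⟩`. -/
def spectralMeasure (M : HilbertOperator.{u}) (v : M) : Measure ℝ :=
  Measure.ofMeasurable
    (fun Ω hΩ => ENNReal.ofReal (⟪v, M.spectralProjection Ω hΩ v⟫_ℂ).re)
    (by simp [spectralProjection_empty])
    (by
      intro s hs hd
      have hsum : HasSum (fun i => (⟪v, M.spectralProjection (s i) (hs i) v⟫_ℂ).re)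
          (⟪v, M.spectralProjection (⋃ i, s i) (MeasurableSet.iUnion hs) v⟫_ℂ).re := by
        rw [hasSum_iff_tendsto_nat_of_nonneg
          fun i => M.re_inner_spectralProjection_nonneg _ (hs i) v]
        have h := (Complex.continuous_re.tendsto _).comp
          ((tendsto_const_nhds (x := v)).inner (𝕜 := ℂ)
            (M.tendsto_sum_spectralProjection s hs hd v))
        simpa only [Function.comp_def, inner_sum, Complex.re_sum] using h
      rw [← hsum.tsum_eq]
      exact ENNReal.ofReal_tsum_of_nonneg
        (fun i => M.re_inner_spectralProjection_nonneg _ (hs i) v) hsum.summable)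

/-- `H_G`: the Hilbert subspace generated by the vectors `f(Q) v`, where `v ∈ G` and `f` is a bounded
Borel function. -/
def generated (M : HilbertOperator.{u}) (G : Set M) : Submodule ℂ M :=
  (Submodule.span ℂ {u : M | ∃ v ∈ G, ∃ f : BoundedBorel, u = M.applyBorel f v}).topologicalClosure

instance (M : HilbertOperator.{u}) (G : Set M) : (M.generated G).HasOrthogonalProjection :=
  inferInstanceAs (Submodule.topologicalClosure _).HasOrthogonalProjection

/-- `P_G`: the orthogonal projection onto `H_G`. -/
def proj (M : HilbertOperator.{u}) (G : Set M) : M →L[ℂ] M :=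
  (M.generated G).starProjection

/-- `P_{G^⊥}`: the orthogonal projection onto the orthogonal complement of `H_G`. -/
def projPerp (M : HilbertOperator.{u}) (G : Set M) : M →L[ℂ] M :=
  (M.generated G)ᗮ.starProjection

end HilbertOperator

end

noncomputable section

/-! ### Bounded measurable functions -/

/-! The vector `v` together with the parameters is determined up to unitary equivalence by the
numbers `⟨x, f(Q)y⟩`, where `x, y` run over the parameters and `v`, and `f` over the bounded Borel
functions. Splitting `v` into its component in `H_G` and the orthogonal remainder `u` removes the
cross terms. These numbers therefore depend only on `P_G v` and on `∫ f dμ_u`.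

Equal types give equal data. A map that carries one graph into another commutes with resolvents,
hence preserves spectral measures and commutes with the whole Borel calculus
(`IsKSubstructure.spectralMeasure_map`, `IsKSubstructure.map_borel`). Two embeddings that agree on
`G` then agree on `H_G`, and both invariants can be read off in the common extension.

Equal data give equal types. By `inner_withParameters` the closed subspace of `M₂` generated by `w`
and `M₀` is carried isometrically onto the one in `M₁` generated by `v` and `M₀`, compatibly with
the calculi (`cyclicIsometry`). The amalgam is the direct sum of `M₁` and the orthogonal complement
of that subspace in `M₂`. It stays in the class (`mem_structureClass_of_sum`). The complement is a
part of `M₂`, so it adds nothing to the spectrum or the essential spectrum. Outside the essential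
spectrum eigenspaces are finite dimensional, so `M₀`, a member of the class, already fills those of
`M₂`, and the complement, orthogonal to `M₀`, has none.

All this needs the spectral theorem, since `applyBorel` has content only once a `BorelCalculus`
exists. It is obtained from the bounded normal operator `(Q - i)⁻¹`: its continuous calculus is
extended to Borel functions by Riesz measures and pulled back along `z ↦ Re (1/z)`. -/

/-- The `*`-algebra of bounded measurable functions `X → ℂ`. -/
def BoundedMeasurable (X : Type*) [MeasurableSpace X] : StarSubalgebra ℂ (X → ℂ) where
  carrier := {f | Measurable f ∧ ∃ C : ℝ, ∀ x, ‖f x‖ ≤ C}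
  mul_mem' := by
    rintro f g ⟨hf, C, hC⟩ ⟨hg, D, hD⟩
    refine ⟨hf.mul hg, C * D, fun x => ?_⟩
    rw [Pi.mul_apply, norm_mul]
    exact mul_le_mul (hC x) (hD x) (norm_nonneg _) ((norm_nonneg _).trans (hC x))
  add_mem' := by
    rintro f g ⟨hf, C, hC⟩ ⟨hg, D, hD⟩
    exact ⟨hf.add hg, C + D, fun x => (norm_add_le _ _).trans (add_le_add (hC x) (hD x))⟩
  algebraMap_mem' r := ⟨measurable_const, ‖r‖, fun _ => le_rfl⟩
  star_mem' := by
    rintro f ⟨hf, C, hC⟩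
    exact ⟨Complex.continuous_conj.measurable.comp hf, C, fun x => by simpa using hC x⟩

namespace BoundedMeasurable

variable {X : Type*} [MeasurableSpace X]

theorem measurable (f : BoundedMeasurable X) : Measurable (f : X → ℂ) := f.2.1

theorem exists_bound (f : BoundedMeasurable X) : ∃ C : ℝ, 0 ≤ C ∧ ∀ x, ‖(f : X → ℂ) x‖ ≤ C := by
  obtain ⟨C, hC⟩ := f.2.2
  exact ⟨|C|, abs_nonneg C, fun x => (hC x).trans (le_abs_self C)⟩

theorem memLp (f : BoundedMeasurable X) (p : ℝ≥0∞) (μ : Measure X) [IsFiniteMeasure μ] :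
    MemLp (f : X → ℂ) p μ := by
  obtain ⟨C, -, hC⟩ := exists_bound f
  exact MemLp.of_bound (measurable f).aestronglyMeasurable C (Eventually.of_forall hC)

theorem norm_toLp_sq {μ : Measure X} {f : X → ℂ} (hf : MemLp f 2 μ) :
    ‖hf.toLp f‖ ^ 2 = ∫ x, ‖f x‖ ^ 2 ∂μ := by
  have h := inner_self_eq_norm_sq_to_K (𝕜 := ℂ) (hf.toLp f)
  rw [MeasureTheory.L2.inner_def] at h
  have h2 : ∫ x, ⟪(hf.toLp f : X → ℂ) x, (hf.toLp f : X → ℂ) x⟫_ℂ ∂μ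
      = ∫ x, ((‖f x‖ ^ 2 : ℝ) : ℂ) ∂μ := by
    refine integral_congr_ae ?_
    filter_upwards [hf.coeFn_toLp] with x hx
    rw [hx, inner_self_eq_norm_sq_to_K]
    norm_cast
  rw [h2, integral_complex_ofReal] at h
  exact (Complex.ofReal_injective (h.trans (RCLike.ofReal_pow _ _).symm)).symm

theorem integrable_norm_sq (f : BoundedMeasurable X) (μ : Measure X) [IsFiniteMeasure μ] :
    Integrable (fun x => ‖(f : X → ℂ) x‖ ^ 2) μ :=
  (memLp f 2 μ).integrable_norm_pow (by norm_num)

/-- A continuous function on a compact space as a bounded measurable function. -/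
def ofContinuous [TopologicalSpace X] [CompactSpace X] [BorelSpace X] :
    C(X, ℂ) →⋆ₐ[ℂ] BoundedMeasurable X where
  toFun g := ⟨g, g.continuous.measurable, ‖g‖, g.norm_coe_le_norm⟩
  map_one' := rfl
  map_mul' _ _ := rfl
  map_zero' := rfl
  map_add' _ _ := rfl
  commutes' _ := rfl
  map_star' _ := rfl

/-- Lets one sequence that approximates in `L²` of a sum of measures serve every summand. -/
theorem tendsto_integral_of_le [TopologicalSpace X] [CompactSpace X] [BorelSpace X]
    {μ ν : Measure X} [IsFiniteMeasure ν] (hμ : μ ≤ ν)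
    {f : BoundedMeasurable X} {g : ℕ → C(X, ℂ)}
    (h : Tendsto (fun n => ∫ x, ‖g n x - (f : X → ℂ) x‖ ^ 2 ∂ν) atTop (𝓝 0)) :
    Tendsto (fun n => ∫ x, ‖g n x - (f : X → ℂ) x‖ ^ 2 ∂μ) atTop (𝓝 0) := by
  refine squeeze_zero (fun n => integral_nonneg fun x => by positivity) (fun n => ?_) h
  exact integral_mono_measure hμ (Eventually.of_forall fun x => by positivity)
    (integrable_norm_sq (ofContinuous (g n) - f) ν)

end BoundedMeasurable

/-! ### Extension of a representation of `C(X, ℂ)` to the bounded Borel functions -/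

namespace StarRepresentation

variable {X : Type*} [TopologicalSpace X]
  {E : Type*} [NormedAddCommGroup E] [InnerProductSpace ℂ E] [CompleteSpace E]
  (π : C(X, ℂ) →⋆ₐ[ℂ] (E →L[ℂ] E))

theorem inner_mul_star_self (f : C(X, ℂ)) (v : E) :
    ⟪v, π (star f * f) v⟫_ℂ = (‖π f v‖ ^ 2 : ℝ) := by
  rw [map_mul, map_star, mul_apply_eq_comp, ContinuousLinearMap.star_eq_adjoint,
    ContinuousLinearMap.adjoint_inner_right, inner_self_eq_norm_sq_to_K]
  norm_cast

/-- A real function as a complex function. -/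
def realToComplex : C(X, ℝ) →ₗ[ℝ] C(X, ℂ) where
  toFun g := ⟨fun x => (g x : ℂ), Complex.continuous_ofReal.comp g.continuous⟩
  map_add' f g := by ext x; simp
  map_smul' c g := by ext x; simp

@[simp]
theorem realToComplex_apply (g : C(X, ℝ)) (x : X) : realToComplex g x = (g x : ℂ) := rfl

theorem re_inner_nonneg {g : C(X, ℝ)} (hg : 0 ≤ g) (v : E) :
    0 ≤ (⟪v, π (realToComplex g) v⟫_ℂ).re := by
  have h : realToComplex g =
      star (realToComplex ⟨fun x => √(g x), g.continuous.sqrt⟩) *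
        realToComplex ⟨fun x => √(g x), g.continuous.sqrt⟩ := by
    ext x
    have hx : 0 ≤ g x := hg x
    simp only [realToComplex_apply, ContinuousMap.mul_apply, ContinuousMap.star_apply,
      ContinuousMap.coe_mk, Complex.star_def, Complex.conj_ofReal]
    rw [← Complex.ofReal_mul, Real.mul_self_sqrt hx]
  rw [h, inner_mul_star_self, Complex.ofReal_re]
  positivity

variable [CompactSpace X] [TopologicalSpace.MetrizableSpace X] [MeasurableSpace X] [BorelSpace X]

open CompactlySupported in
/-- The positive functional `g ↦ ⟨v, π(g) v⟩`. -/
def positiveFunctional (v : E) : C_c(X, ℝ) →ₚ[ℝ] ℝ where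
  toFun g := (⟪v, π (realToComplex g.toContinuousMap) v⟫_ℂ).re
  map_add' f g := by
    have : (f + g).toContinuousMap = f.toContinuousMap + g.toContinuousMap := rfl
    rw [this, map_add, map_add, add_apply, inner_add_right, Complex.add_re]
  map_smul' c g := by
    have : realToComplex (c • g).toContinuousMap = (c : ℂ) • realToComplex g.toContinuousMap := by
      ext x; simp
    rw [this, map_smul, smul_apply, inner_smul_right, Complex.re_ofReal_mul]
    rfl
  monotone' f g hfg := by
    have h := re_inner_nonneg π (g := g.toContinuousMap - f.toContinuousMap)
      (fun x => sub_nonneg.2 (hfg x)) v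
    rw [map_sub, map_sub, sub_apply, inner_sub_right, Complex.sub_re] at h
    exact sub_nonneg.1 h

/-- The measure `μ_v` with `⟨v, π(f) v⟩ = ∫ f dμ_v`. -/
def measure (v : E) : Measure X := RealRMK.rieszMeasure (positiveFunctional π v)

instance (v : E) : IsFiniteMeasure (measure π v) :=
  inferInstanceAs (IsFiniteMeasure (RealRMK.rieszMeasure _))

theorem re_inner_eq_integral (g : C(X, ℝ)) (v : E) :
    (⟪v, π (realToComplex g) v⟫_ℂ).re = ∫ x, g x ∂(measure π v) :=
  (RealRMK.integral_rieszMeasure (positiveFunctional π v)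
    ⟨g, HasCompactSupport.of_compactSpace _⟩).symm

theorem norm_sq_eq_integral (f : C(X, ℂ)) (v : E) :
    ‖π f v‖ ^ 2 = ∫ x, ‖f x‖ ^ 2 ∂(measure π v) := by
  have h : star f * f = realToComplex ⟨fun x => ‖f x‖ ^ 2, by fun_prop⟩ := by
    ext x
    simp only [ContinuousMap.mul_apply, ContinuousMap.star_apply, realToComplex_apply,
      ContinuousMap.coe_mk, Complex.star_def]
    rw [Complex.conj_mul', Complex.ofReal_pow]
  have h2 := congrArg Complex.re (inner_mul_star_self π f v)
  rw [h, re_inner_eq_integral, Complex.ofReal_re] at h2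
  exact h2.symm

/-- The map `f ↦ π(f) v`. -/
def orbitMap (v : E) : C(X, ℂ) →ₗ[ℂ] E where
  toFun f := π f v
  map_add' f g := by simp
  map_smul' c f := by simp

/-- The class of a continuous function in `L²(μ_v)`. -/
def toL2 (v : E) : C(X, ℂ) →ₗ[ℂ] Lp ℂ 2 (measure π v) :=
  (ContinuousMap.toLp 2 (measure π v) ℂ : C(X, ℂ) →L[ℂ] Lp ℂ 2 (measure π v)).toLinearMap

theorem denseRange_toL2 (v : E) : DenseRange (toL2 π v) :=
  ContinuousMap.toLp_denseRange ℂ (measure π v) ℂ (by norm_num)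

/-- Hence `π f v` depends only on the class of `f` in `L²(μ_v)`, and the orbit map extends to all of
`L²(μ_v)` by density. -/
theorem norm_toL2 (v : E) (f : C(X, ℂ)) : ‖toL2 π v f‖ = ‖orbitMap π v f‖ := by
  refine (pow_left_inj₀ (norm_nonneg _) (norm_nonneg _) two_ne_zero).1 ?_
  exact (BoundedMeasurable.norm_toLp_sq (BoundedMeasurable.memLp
    (BoundedMeasurable.ofContinuous f) 2 (measure π v))).trans (norm_sq_eq_integral π f v).symm

theorem extendOfNorm_toL2 (v : E) (f : C(X, ℂ)) :
    (orbitMap π v).extendOfNorm (toL2 π v) (toL2 π v f) = π f v :=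
  LinearMap.extendOfNorm_eq (denseRange_toL2 π v)
    ⟨1, fun g => by rw [norm_toL2, one_mul]⟩ f

/-- The isometry from `L²(μ_v)` which maps the class of `f` to `π(f) v`. -/
def isometry (v : E) : Lp ℂ 2 (measure π v) →ₗᵢ[ℂ] E where
  toLinearMap := ((orbitMap π v).extendOfNorm (toL2 π v)).toLinearMap
  norm_map' := by
    refine isClosed_property (denseRange_toL2 π v)
      (isClosed_eq (ContinuousLinearMap.continuous _).norm continuous_norm) fun f => ?_
    rw [norm_toL2]
    exact congrArg norm (extendOfNorm_toL2 π v f)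

theorem isometry_toL2 (v : E) (f : C(X, ℂ)) : isometry π v (toL2 π v f) = π f v :=
  extendOfNorm_toL2 π v f

/-- The vector `f v` for a bounded Borel function `f`. -/
def act (f : BoundedMeasurable X) (v : E) : E :=
  isometry π v ((BoundedMeasurable.memLp f 2 (measure π v)).toLp f)

theorem act_ofContinuous (f : C(X, ℂ)) (v : E) :
    act π (BoundedMeasurable.ofContinuous f) v = π f v :=
  isometry_toL2 π v f

theorem norm_act_sq (f : BoundedMeasurable X) (v : E) :
    ‖act π f v‖ ^ 2 = ∫ x, ‖(f : X → ℂ) x‖ ^ 2 ∂(measure π v) := by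
  rw [act, LinearIsometry.norm_map, BoundedMeasurable.norm_toLp_sq]

theorem act_add_left (f g : BoundedMeasurable X) (v : E) :
    act π (f + g) v = act π f v + act π g v := by
  rw [act, act, act, ← map_add]
  rfl

theorem act_smul_left (c : ℂ) (f : BoundedMeasurable X) (v : E) :
    act π (c • f) v = c • act π f v := by
  rw [act, act, ← map_smul]
  rfl

theorem act_sub_left (f g : BoundedMeasurable X) (v : E) :
    act π (f - g) v = act π f v - act π g v := by
  rw [act, act, act, ← map_sub]
  rfl

theorem tendsto_act {f : ℕ → BoundedMeasurable X} {g : BoundedMeasurable X} {v : E}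
    (h : Tendsto (fun n => ∫ x, ‖(f n : X → ℂ) x - (g : X → ℂ) x‖ ^ 2 ∂(measure π v)) atTop (𝓝 0)) :
    Tendsto (fun n => act π (f n) v) atTop (𝓝 (act π g v)) := by
  rw [tendsto_iff_norm_sub_tendsto_zero]
  have h2 : ∀ n, ‖act π (f n) v - act π g v‖ =
      √(∫ x, ‖(f n : X → ℂ) x - (g : X → ℂ) x‖ ^ 2 ∂(measure π v)) := fun n => by
    rw [← act_sub_left, ← Real.sqrt_sq (norm_nonneg (act π (f n - g) v)), norm_act_sq]
    rfl
  simp only [h2]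
  simpa using h.sqrt

/-- Dominated convergence for bounded Borel functions of a representation. -/
theorem tendsto_act_of_bounded {f : ℕ → BoundedMeasurable X} {g : BoundedMeasurable X} (v : E)
    (h : ∀ x, Tendsto (fun n => (f n : X → ℂ) x) atTop (𝓝 ((g : X → ℂ) x)))
    (hb : ∃ C : ℝ, ∀ n x, ‖(f n : X → ℂ) x‖ ≤ C) :
    Tendsto (fun n => act π (f n) v) atTop (𝓝 (act π g v)) := by
  obtain ⟨C, hC⟩ := hb
  obtain ⟨D, -, hD⟩ := BoundedMeasurable.exists_bound g
  refine tendsto_act π ?_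
  have h0 : (0 : ℝ) = ∫ x, (0 : ℝ) ∂(measure π v) := by simp
  rw [h0]
  refine tendsto_integral_of_dominated_convergence (fun _ => (C + D) ^ 2) (fun n => ?_)
    (integrable_const _) (fun n => Eventually.of_forall fun x => ?_)
    (Eventually.of_forall fun x => ?_)
  · exact (BoundedMeasurable.integrable_norm_sq (f n - g) _).aestronglyMeasurable
  · rw [norm_pow, norm_norm]
    exact pow_le_pow_left₀ (norm_nonneg _) ((norm_sub_le _ _).trans (add_le_add (hC n x) (hD x))) 2
  · have := ((h x).sub_const ((g : X → ℂ) x)).norm.pow 2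
    simpa using this

/-- A bounded Borel function is a limit of continuous functions in `L²` of a finite measure. -/
theorem exists_seq_tendsto (f : BoundedMeasurable X) (μ : Measure X) [IsFiniteMeasure μ] :
    ∃ g : ℕ → C(X, ℂ), Tendsto (fun n => ∫ x, ‖g n x - (f : X → ℂ) x‖ ^ 2 ∂μ) atTop (𝓝 0) := by
  have hf : MemLp (f : X → ℂ) (ENNReal.ofReal 2) μ := BoundedMeasurable.memLp f _ μ
  choose g hg _ using fun n : ℕ =>
    hf.exists_boundedContinuous_integral_rpow_sub_le two_pos
      (Nat.one_div_pos_of_nat (α := ℝ) (n := n))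
  refine ⟨fun n => (g n).toContinuousMap, squeeze_zero
    (fun n => integral_nonneg fun x => by positivity)
    (fun n => ?_) tendsto_one_div_add_atTop_nhds_zero_nat⟩
  refine le_trans (le_of_eq ?_) (hg n)
  refine integral_congr_ae (Eventually.of_forall fun x => ?_)
  have h : (2 : ℝ) = ((2 : ℕ) : ℝ) := by norm_num
  simp only
  rw [h, Real.rpow_natCast, norm_sub_rev]
  rfl

/-- A bounded Borel function is approximated by continuous functions at three vectors. -/
theorem exists_seq_tendsto_three (f : BoundedMeasurable X) (a b c : E) :
    ∃ g : ℕ → C(X, ℂ), ∀ v ∈ ({a, b, c} : Set E),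
      Tendsto (fun n => ∫ x, ‖g n x - (f : X → ℂ) x‖ ^ 2 ∂(measure π v)) atTop (𝓝 0) := by
  obtain ⟨g, hg⟩ := exists_seq_tendsto f (measure π a + measure π b + measure π c)
  refine ⟨g, ?_⟩
  rintro v (rfl | rfl | rfl)
  · exact BoundedMeasurable.tendsto_integral_of_le
      ((Measure.le_add_right le_rfl).trans (Measure.le_add_right le_rfl)) hg
  · exact BoundedMeasurable.tendsto_integral_of_le
      ((Measure.le_add_left le_rfl).trans (Measure.le_add_right le_rfl)) hg
  · exact BoundedMeasurable.tendsto_integral_of_le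
      (Measure.le_add_left le_rfl) hg

theorem tendsto_continuous {f : BoundedMeasurable X} {g : ℕ → C(X, ℂ)} {v : E}
    (h : Tendsto (fun n => ∫ x, ‖g n x - (f : X → ℂ) x‖ ^ 2 ∂(measure π v)) atTop (𝓝 0)) :
    Tendsto (fun n => π (g n) v) atTop (𝓝 (act π f v)) := by
  refine (tendsto_act π (f := fun n => BoundedMeasurable.ofContinuous (g n)) h).congr fun n => ?_
  exact act_ofContinuous π (g n) v

/-- Not immediate, because `a`, `b` and `a + b` come with three different measures. A single
sequence of continuous functions that approximates `f` in all three `L²` spaces transfers the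
additivity of `π (g n)`. -/
theorem act_add (f : BoundedMeasurable X) (a b : E) : act π f (a + b) = act π f a + act π f b := by
  obtain ⟨g, hg⟩ := exists_seq_tendsto_three π f a b (a + b)
  refine tendsto_nhds_unique (tendsto_continuous π (hg (a + b) (by simp))) ?_
  simpa only [map_add] using
    (tendsto_continuous π (hg a (by simp))).add (tendsto_continuous π (hg b (by simp)))

theorem act_smul (f : BoundedMeasurable X) (c : ℂ) (a : E) : act π f (c • a) = c • act π f a := by
  obtain ⟨g, hg⟩ := exists_seq_tendsto_three π f a a (c • a)
  refine tendsto_nhds_unique (tendsto_continuous π (hg (c • a) (by simp))) ?_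
  simpa only [map_smul] using (tendsto_continuous π (hg a (by simp))).const_smul c

theorem act_star (f : BoundedMeasurable X) (a b : E) :
    ⟪act π (star f) a, b⟫_ℂ = ⟪a, act π f b⟫_ℂ := by
  obtain ⟨g, hg⟩ := exists_seq_tendsto_three π f a b b
  have h1 : Tendsto (fun n => π (star (g n)) a) atTop (𝓝 (act π (star f) a)) := by
    refine tendsto_continuous π ((hg a (by simp)).congr fun n => ?_)
    refine integral_congr_ae (Eventually.of_forall fun x => ?_)
    change ‖g n x - (f : X → ℂ) x‖ ^ 2 = ‖star (g n x) - star ((f : X → ℂ) x)‖ ^ 2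
    rw [← star_sub, norm_star]
  refine tendsto_nhds_unique (h1.inner tendsto_const_nhds) ?_
  refine ((tendsto_const_nhds (x := a)).inner (tendsto_continuous π (hg b (by simp)))).congr
    fun n => ?_
  rw [map_star, ContinuousLinearMap.star_eq_adjoint, ContinuousLinearMap.adjoint_inner_left]

theorem tendsto_act_mul {f g : BoundedMeasurable X} {k : ℕ → BoundedMeasurable X} {v : E}
    (h : Tendsto (fun n => ∫ x, ‖(k n : X → ℂ) x - (f : X → ℂ) x‖ ^ 2 ∂(measure π v)) atTop (𝓝 0)) :
    Tendsto (fun n => act π (k n * g) v) atTop (𝓝 (act π (f * g) v)) := by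
  obtain ⟨C, hC0, hC⟩ := BoundedMeasurable.exists_bound g
  refine tendsto_act π (squeeze_zero (fun n => integral_nonneg fun x => by positivity) (fun n => ?_)
    (by simpa using h.const_mul (C ^ 2)))
  rw [← integral_const_mul]
  refine integral_mono (BoundedMeasurable.integrable_norm_sq (k n * g - f * g) _)
    ((BoundedMeasurable.integrable_norm_sq (k n - f) _).const_mul _) fun x => ?_
  change ‖(k n : X → ℂ) x * (g : X → ℂ) x - (f : X → ℂ) x * (g : X → ℂ) x‖ ^ 2 ≤ _
  rw [← sub_mul, norm_mul, mul_pow, mul_comm]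
  exact mul_le_mul_of_nonneg_right (pow_le_pow_left₀ (norm_nonneg _) (hC x) 2) (by positivity)

/-- Multiplicativity is proved in two stages: here the left factor is continuous and the right one
is approximated; in `act_mul` the left factor is approximated in turn. -/
theorem act_ofContinuous_mul (k : C(X, ℂ)) (g : BoundedMeasurable X) (v : E) :
    act π (BoundedMeasurable.ofContinuous k * g) v = π k (act π g v) := by
  obtain ⟨l, hl⟩ := exists_seq_tendsto_three π g v v v
  have h1 := tendsto_act_mul π (g := BoundedMeasurable.ofContinuous k)
    (k := fun n => BoundedMeasurable.ofContinuous (l n))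
    (hl v (by simp))
  have h2 := ((π k).continuous.tendsto _).comp (tendsto_continuous π (hl v (by simp)))
  rw [mul_comm] at h1
  refine tendsto_nhds_unique h1 (h2.congr fun n => ?_)
  rw [← map_mul, act_ofContinuous, mul_comm, map_mul]
  rfl

theorem act_mul (f g : BoundedMeasurable X) (v : E) : act π (f * g) v = act π f (act π g v) := by
  -- The approximation is needed at `v` for the product side and at `act π g v` for the composition
  -- side.
  obtain ⟨k, hk⟩ := exists_seq_tendsto_three π f v (act π g v) v
  have h1 := tendsto_act_mul π (g := g) (k := fun n => BoundedMeasurable.ofContinuous (k n))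
    (hk v (by simp))
  refine tendsto_nhds_unique h1 ?_
  simpa only [act_ofContinuous_mul] using tendsto_continuous π (hk (act π g v) (by simp))

theorem act_one (v : E) : act π 1 v = v := by
  have h := act_ofContinuous π 1 v
  rw [map_one, map_one] at h
  exact h

theorem norm_act_le (f : BoundedMeasurable X) {C : ℝ} (hC0 : 0 ≤ C) (hC : ∀ x, ‖(f : X → ℂ) x‖ ≤ C)
    (v : E) : ‖act π f v‖ ≤ C * ‖v‖ := by
  refine (sq_le_sq₀ (norm_nonneg _) (by positivity)).1 ?_
  have h1 := norm_act_sq π 1 v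
  rw [act_one] at h1
  rw [norm_act_sq, mul_pow, h1, ← integral_const_mul]
  refine integral_mono (BoundedMeasurable.integrable_norm_sq f _)
    ((BoundedMeasurable.integrable_norm_sq 1 _).const_mul _) fun x => ?_
  change _ ≤ C ^ 2 * ‖(1 : ℂ)‖ ^ 2
  rw [norm_one, one_pow, mul_one]
  exact pow_le_pow_left₀ (norm_nonneg _) (hC x) 2

/-- The bounded operator given by a bounded Borel function. -/
def actCLM (f : BoundedMeasurable X) : E →L[ℂ] E :=
  LinearMap.mkContinuousOfExistsBound
    { toFun := act π f
      map_add' := act_add π f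
      map_smul' := act_smul π f }
    (let ⟨C, hC0, hC⟩ := BoundedMeasurable.exists_bound f
     ⟨C, norm_act_le π f hC0 hC⟩)

/-- The extension of a representation of `C(X, ℂ)` to the bounded Borel functions. -/
def extension : BoundedMeasurable X →⋆ₐ[ℂ] (E →L[ℂ] E) :=
  { AlgHom.ofLinearMap
      ({ toFun := actCLM π
         map_add' := fun f g => ContinuousLinearMap.ext fun v => act_add_left π f g v
         map_smul' := fun c f => ContinuousLinearMap.ext fun v => act_smul_left π c f v } :
        BoundedMeasurable X →ₗ[ℂ] (E →L[ℂ] E))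
      (ContinuousLinearMap.ext fun v => act_one π v)
      (fun f g => ContinuousLinearMap.ext fun v => act_mul π f g v) with
    map_star' := fun f => by
      change actCLM π (star f) = star (actCLM π f)
      rw [ContinuousLinearMap.star_eq_adjoint, ContinuousLinearMap.eq_adjoint_iff]
      exact act_star π f }

end StarRepresentation

namespace HilbertOperator

/-! ### Self-adjointness in terms of the graph -/

/-- Self-adjointness without domains: the graph is its own adjoint relation. Sums and restrictions
are checked in this form and passed to `ofGraph`. -/
theorem mem_graph_iff_inner (M : HilbertOperator.{u}) (p : M × M) :
    p ∈ M.Q.graph ↔ ∀ q ∈ M.Q.graph, ⟪q.2, p.1⟫_ℂ = ⟪q.1, p.2⟫_ℂ := by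
  have h := LinearPMap.adjoint_graph_eq_graph_adjoint M.selfAdjoint.dense_domain
  rw [LinearPMap.isSelfAdjoint_def.1 M.selfAdjoint] at h
  conv_lhs => rw [h]
  rw [Submodule.mem_adjoint_iff]
  simp only [sub_eq_zero, Prod.forall]

theorem inner_symm_of_mem_graph (M : HilbertOperator.{u}) {p q : M × M} (hp : p ∈ M.Q.graph)
    (hq : q ∈ M.Q.graph) : ⟪q.2, p.1⟫_ℂ = ⟪q.1, p.2⟫_ℂ :=
  (M.mem_graph_iff_inner p).1 hp q hq

theorem isClosed_graph (M : HilbertOperator.{u}) : IsClosed (M.Q.graph : Set (M × M)) :=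
  M.selfAdjoint.isClosed

/-- The self-adjoint operator with a given graph. -/
def ofGraph {E : Type u} [NormedAddCommGroup E] [InnerProductSpace ℂ E] [CompleteSpace E]
    (g : Submodule ℂ (E × E)) (hg : ∀ p, p ∈ g ↔ ∀ q ∈ g, ⟪q.2, p.1⟫_ℂ = ⟪q.1, p.2⟫_ℂ)
    (h0 : ∀ y, (0, y) ∈ g → y = 0) : HilbertOperator.{u} where
  carrier := E
  Q := g.toLinearPMap
  selfAdjoint := by
    have h1 : ∀ x ∈ g, x.1 = 0 → x.2 = 0 := by
      rintro ⟨x, y⟩ hx (rfl : x = 0)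
      exact h0 y hx
    have hgr : g.toLinearPMap.graph = g := g.toLinearPMap_graph_eq h1
    -- If `y` is orthogonal to the domain, then `(0, y)` satisfies the criterion `hg`, so it lies in
    -- `g` and `y = 0`.
    have hd : Dense (g.toLinearPMap.domain : Set E) := by
      rw [Submodule.dense_iff_topologicalClosure_eq_top,
        Submodule.topologicalClosure_eq_top_iff, Submodule.eq_bot_iff]
      intro y hy
      refine h0 y ((hg _).2 fun q hq => ?_)
      rw [inner_zero_right, (Submodule.mem_orthogonal _ _).1 hy q.1]
      exact LinearPMap.mem_domain_of_mem_graph (y := q.2) (by rw [hgr]; exact hq)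
    rw [LinearPMap.isSelfAdjoint_def]
    refine LinearPMap.eq_of_eq_graph ?_
    rw [LinearPMap.adjoint_graph_eq_graph_adjoint hd, hgr]
    ext p
    rw [Submodule.mem_adjoint_iff, hg p]
    simp only [sub_eq_zero, Prod.forall]

theorem graph_ofGraph {E : Type u} [NormedAddCommGroup E] [InnerProductSpace ℂ E] [CompleteSpace E]
    (g : Submodule ℂ (E × E)) (hg : ∀ p, p ∈ g ↔ ∀ q ∈ g, ⟪q.2, p.1⟫_ℂ = ⟪q.1, p.2⟫_ℂ)
    (h0 : ∀ y, (0, y) ∈ g → y = 0) : (ofGraph g hg h0).Q.graph = g :=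
  g.toLinearPMap_graph_eq (by
    rintro ⟨x, y⟩ hx (rfl : x = 0)
    exact h0 y hx)

/-! ### The resolvent -/

variable (M : HilbertOperator.{u})

/-- `⟨x, Qx⟩` is real, so the imaginary part of `⟨x, (Q - z)x⟩` is `-Im z ‖x‖²`; then
Cauchy–Schwarz. -/
theorem abs_im_mul_norm_le {z : ℂ} {x y : M} (h : (x, y) ∈ M.Q.graph) :
    |z.im| * ‖x‖ ≤ ‖y - z • x‖ := by
  have hr : (⟪x, y⟫_ℂ).im = 0 := by
    rw [← Complex.conj_eq_iff_im, inner_conj_symm]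
    exact M.inner_symm_of_mem_graph h h
  have h2 : (⟪x, y - z • x⟫_ℂ).im = -(z.im * ‖x‖ ^ 2) := by
    have hx : ⟪x, x⟫_ℂ = ((‖x‖ ^ 2 : ℝ) : ℂ) := by
      rw [inner_self_eq_norm_sq_to_K]
      norm_cast
    rw [inner_sub_right, inner_smul_right, hx, Complex.sub_im, hr, zero_sub, Complex.im_mul_ofReal]
  have h3 : |z.im| * ‖x‖ * ‖x‖ ≤ ‖y - z • x‖ * ‖x‖ := by
    calc |z.im| * ‖x‖ * ‖x‖ = |(⟪x, y - z • x⟫_ℂ).im| := by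
          rw [h2, abs_neg, abs_mul, abs_of_nonneg (sq_nonneg ‖x‖)]; ring
      _ ≤ ‖⟪x, y - z • x⟫_ℂ‖ := Complex.abs_im_le_norm _
      _ ≤ ‖x‖ * ‖y - z • x‖ := norm_inner_le_norm _ _
      _ = _ := mul_comm _ _
  rcases (norm_nonneg x).eq_or_lt with h0 | h0
  · rw [← h0, mul_zero]; exact norm_nonneg _
  · exact le_of_mul_le_mul_right h3 h0

/-- `Q - z` is bounded below on a closed graph, so its range is closed. A vector orthogonal to the
range is an eigenvector at the conjugate of `z`, which `abs_im_mul_norm_le` forces to vanish. -/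
theorem exists_resolvent {z : ℂ} (hz : z.im ≠ 0) (u : M) : ∃ x : M, (x, u + z • x) ∈ M.Q.graph := by
  let L : M.Q.graph →L[ℂ] M :=
    (ContinuousLinearMap.snd ℂ M M - z • ContinuousLinearMap.fst ℂ M M).comp M.Q.graph.subtypeL
  have hL : ∀ p : M.Q.graph, L p = p.1.2 - z • p.1.1 := fun p => rfl
  have hz' : 0 < |z.im| := abs_pos.2 hz
  have : CompleteSpace M.Q.graph := M.isClosed_graph.completeSpace_coe
  -- The constant is the sum of the bounds for `‖x‖` and `‖y‖`; it dominates their maximum, which is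
  -- the norm of the pair.
  have hanti : AntilipschitzWith (Real.toNNReal (|z.im|⁻¹ + (1 + ‖z‖ * |z.im|⁻¹))) L := by
    refine AddMonoidHomClass.antilipschitz_of_bound L fun p => ?_
    rw [Real.coe_toNNReal _ (by positivity), hL]
    obtain ⟨⟨x, y⟩, hp⟩ := p
    simp only
    have h1 : ‖x‖ ≤ |z.im|⁻¹ * ‖y - z • x‖ := by
      rw [inv_mul_eq_div, le_div_iff₀ hz', mul_comm]
      exact M.abs_im_mul_norm_le hp
    have h2 : ‖y‖ ≤ ‖y - z • x‖ + ‖z‖ * ‖x‖ := by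
      rw [← norm_smul]
      simpa using norm_add_le (y - z • x) (z • x)
    have h3 : ‖z‖ * ‖x‖ ≤ ‖z‖ * (|z.im|⁻¹ * ‖y - z • x‖) := by gcongr
    have h4 : 0 ≤ |z.im|⁻¹ * ‖y - z • x‖ := by positivity
    have h5 : 0 ≤ ‖z‖ * (|z.im|⁻¹ * ‖y - z • x‖) := by positivity
    refine max_le ?_ ?_
    · change ‖x‖ ≤ _
      nlinarith [norm_nonneg (y - z • x)]
    · change ‖y‖ ≤ _
      nlinarith
  have hclosed : IsClosed (L.range : Set M) := by
    rw [LinearMap.coe_range]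
    exact hanti.isClosed_range L.uniformContinuous
  have htop : L.range = ⊤ := by
    rw [← hclosed.submodule_topologicalClosure_eq, Submodule.topologicalClosure_eq_top_iff,
      Submodule.eq_bot_iff]
    intro v hv
    have hg : (v, (starRingEnd ℂ) z • v) ∈ M.Q.graph := by
      refine (M.mem_graph_iff_inner _).2 fun q hq => ?_
      have h1 := (Submodule.mem_orthogonal _ _).1 hv (L ⟨q, hq⟩) ⟨_, rfl⟩
      rw [hL, inner_sub_left, inner_smul_left, sub_eq_zero] at h1
      rw [inner_smul_right]
      exact h1
    have h2 := M.abs_im_mul_norm_le (z := (starRingEnd ℂ) z) hg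
    rw [sub_self, norm_zero, Complex.conj_im, abs_neg] at h2
    have : ‖v‖ ≤ 0 := by
      by_contra! h
      exact absurd h2 (not_le.2 (mul_pos hz' h))
    exact norm_le_zero_iff.1 this
  obtain ⟨⟨⟨x, y⟩, hp⟩, h⟩ : u ∈ L.range := htop ▸ Submodule.mem_top
  refine ⟨x, ?_⟩
  have h' : y - z • x = u := h
  rw [← h', sub_add_cancel]
  exact hp

theorem eq_of_mem_graph {z : ℂ} (hz : z.im ≠ 0) {x y x' y' : M} (h : (x, y) ∈ M.Q.graph)
    (h' : (x', y') ∈ M.Q.graph) (he : y - z • x = y' - z • x') : x = x' := by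
  have h1 := M.abs_im_mul_norm_le (z := z) (M.Q.graph.sub_mem h h')
  have h2 : y - y' - z • (x - x') = 0 := by
    rw [smul_sub, sub_sub_sub_comm, he, sub_self]
  change |z.im| * ‖x - x'‖ ≤ ‖y - y' - z • (x - x')‖ at h1
  rw [h2, norm_zero] at h1
  by_contra hne
  exact absurd h1 (not_le.2 (mul_pos (abs_pos.2 hz) (norm_pos_iff.2 (sub_ne_zero.2 hne))))

/-- The resolvent `(Q - z)⁻¹` at a point `z` off the real line. -/
def resolvent {z : ℂ} (hz : z.im ≠ 0) : M →L[ℂ] M :=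
  LinearMap.mkContinuous
    { toFun := fun u => (M.exists_resolvent hz u).choose
      map_add' := fun u v => by
        refine M.eq_of_mem_graph hz (M.exists_resolvent hz (u + v)).choose_spec
          (M.Q.graph.add_mem (M.exists_resolvent hz u).choose_spec
            (M.exists_resolvent hz v).choose_spec) ?_
        simp only [smul_add]
        abel
      map_smul' := fun c u => by
        refine M.eq_of_mem_graph hz (M.exists_resolvent hz (c • u)).choose_spec
          (M.Q.graph.smul_mem c (M.exists_resolvent hz u).choose_spec) ?_
        simp only [RingHom.id_apply, smul_add, smul_comm z c]
        abel } |z.im|⁻¹ (fun u => by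
      have h := M.abs_im_mul_norm_le (z := z) (M.exists_resolvent hz u).choose_spec
      rw [add_sub_cancel_right] at h
      rw [inv_mul_eq_div, le_div_iff₀ (abs_pos.2 hz), mul_comm]
      exact h)

variable {M}

theorem resolvent_mem_graph {z : ℂ} (hz : z.im ≠ 0) (u : M) :
    (M.resolvent hz u, u + z • M.resolvent hz u) ∈ M.Q.graph :=
  (M.exists_resolvent hz u).choose_spec

theorem resolvent_apply_of_mem_graph {z : ℂ} (hz : z.im ≠ 0) {x y : M} (h : (x, y) ∈ M.Q.graph) :
    M.resolvent hz (y - z • x) = x :=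
  M.eq_of_mem_graph hz (resolvent_mem_graph hz _) h (by rw [add_sub_cancel_right])

theorem mem_graph_iff_resolvent {z : ℂ} (hz : z.im ≠ 0) {x y : M} :
    (x, y) ∈ M.Q.graph ↔ M.resolvent hz (y - z • x) = x := by
  refine ⟨resolvent_apply_of_mem_graph hz, fun h => ?_⟩
  have h2 := resolvent_mem_graph hz (y - z • x)
  rwa [h, sub_add_cancel] at h2

theorem resolvent_injective {z : ℂ} (hz : z.im ≠ 0) : Function.Injective (M.resolvent hz) := by
  refine (injective_iff_map_eq_zero _).2 fun u hu => ?_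
  have h := resolvent_mem_graph hz u
  rw [hu, smul_zero, add_zero] at h
  exact M.Q.graph_fst_eq_zero_snd h rfl

theorem adjoint_resolvent {z w : ℂ} (hz : z.im ≠ 0) (hw : w.im ≠ 0) (h : (starRingEnd ℂ) z = w) :
    star (M.resolvent hz) = M.resolvent hw := by
  subst h
  rw [ContinuousLinearMap.star_eq_adjoint, eq_comm, ContinuousLinearMap.eq_adjoint_iff]
  intro a b
  have h1 := M.inner_symm_of_mem_graph (resolvent_mem_graph hz b) (resolvent_mem_graph hw a)
  simp only [inner_add_left, inner_add_right, inner_smul_left, inner_smul_right,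
    Complex.conj_conj] at h1
  exact (add_right_cancel h1).symm

theorem resolvent_identity {z w : ℂ} (hz : z.im ≠ 0) (hw : w.im ≠ 0) :
    M.resolvent hz - M.resolvent hw = (z - w) • (M.resolvent hz * M.resolvent hw) := by
  ext u
  have h := resolvent_apply_of_mem_graph hz (resolvent_mem_graph hw u)
  rw [add_sub_assoc, ← sub_smul, map_add, map_smul] at h
  simp only [sub_apply, smul_apply, mul_apply_eq_comp]
  nth_rewrite 1 [← h]
  module

theorem I_im_ne_zero : Complex.I.im ≠ 0 := by simp

theorem neg_I_im_ne_zero : (-Complex.I).im ≠ 0 := by simp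

theorem star_resolvent_I : star (M.resolvent I_im_ne_zero) = M.resolvent neg_I_im_ne_zero :=
  adjoint_resolvent _ _ Complex.conj_I

/-- Used twice: for normality, and to place the spectrum on the circle `Im z = |z|²`, the image of
the real line under `x ↦ 1 / (x - i)` with `0` added. -/
theorem resolvent_I_sub_star :
    M.resolvent I_im_ne_zero - star (M.resolvent I_im_ne_zero) =
      (2 * Complex.I) • (M.resolvent I_im_ne_zero * star (M.resolvent I_im_ne_zero)) := by
  rw [star_resolvent_I, resolvent_identity, sub_neg_eq_add, ← two_mul]

instance isStarNormal_resolvent_I : IsStarNormal (M.resolvent I_im_ne_zero) := by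
  constructor
  have h1 := resolvent_I_sub_star (M := M)
  -- Exchanging `i` and `-i` reverses the order of the product; comparison with `h1` gives
  -- commutation.
  have h2 := resolvent_identity (M := M) neg_I_im_ne_zero I_im_ne_zero
  rw [← star_resolvent_I, ← neg_sub, h1, ← neg_smul, ← neg_add', ← two_mul] at h2
  exact (smul_right_injective _ (by simp) h2).symm

end HilbertOperator

/-! ### The spectral theorem, by way of the resolvent at `i` -/

/-- Composition of bounded Borel functions on `ℝ` with a measurable map. -/
def BoundedBorel.comp {X : Type*} [MeasurableSpace X] {φ : X → ℝ} (hφ : Measurable φ) :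
    BoundedBorel →⋆ₐ[ℂ] BoundedMeasurable X where
  toFun f := ⟨(f : ℝ → ℂ) ∘ φ, f.2.1.comp hφ, f.2.2.imp fun _ hC x => hC (φ x)⟩
  map_one' := rfl
  map_mul' _ _ := rfl
  map_zero' := rfl
  map_add' _ _ := rfl
  commutes' _ := rfl
  map_star' _ := rfl

namespace HilbertOperator

open StarRepresentation BoundedMeasurable

variable (M : HilbertOperator.{u})

/-- The spectrum of the resolvent at `i`. -/
abbrev ResolventSpectrum : Type := _root_.spectrum ℂ (M.resolvent I_im_ne_zero)

/-- The continuous functional calculus of the resolvent at `i`. -/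
def resolventCalculus : C(M.ResolventSpectrum, ℂ) →⋆ₐ[ℂ] (M →L[ℂ] M) :=
  cfcHom (p := IsStarNormal) (a := M.resolvent I_im_ne_zero) isStarNormal_resolvent_I

/-- The inclusion of the spectrum in `ℂ`. -/
def resolventCoord : C(M.ResolventSpectrum, ℂ) := ⟨Subtype.val, continuous_subtype_val⟩

theorem resolventCalculus_coord : M.resolventCalculus M.resolventCoord = M.resolvent I_im_ne_zero :=
  cfcHom_id (p := IsStarNormal) (a := M.resolvent I_im_ne_zero) isStarNormal_resolvent_I

/-- The real number `x` such that `z = 1 / (x - i)`. -/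
def resolventReal (z : M.ResolventSpectrum) : ℝ := ((z : ℂ)⁻¹).re

theorem measurable_resolventReal : Measurable M.resolventReal :=
  Complex.measurable_re.comp (measurable_subtype_coe.inv)

/-- The continuous functional calculus is injective, so an identity between operators becomes one
between functions on the spectrum. -/
theorem sub_conj_of_mem_spectrum (z : M.ResolventSpectrum) :
    (z : ℂ) - (starRingEnd ℂ) z = 2 * Complex.I * (z * (starRingEnd ℂ) z) := by
  have h : M.resolventCoord - star M.resolventCoord =
      (2 * Complex.I) • (M.resolventCoord * star M.resolventCoord) := by
    refine cfcHom_injective (p := IsStarNormal) (a := M.resolvent I_im_ne_zero)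
      isStarNormal_resolvent_I ?_
    change M.resolventCalculus _ = M.resolventCalculus _
    rw [map_sub, map_smul, map_mul, map_star, resolventCalculus_coord, resolvent_I_sub_star]
  exact DFunLike.congr_fun h z

theorem inv_eq_resolventReal_sub_I (z : M.ResolventSpectrum) (hz : (z : ℂ) ≠ 0) :
    (z : ℂ)⁻¹ = M.resolventReal z - Complex.I := by
  have h := M.sub_conj_of_mem_spectrum z
  have hz' : (starRingEnd ℂ) (z : ℂ) ≠ 0 := (map_ne_zero _).2 hz
  have h2 : (starRingEnd ℂ) (z : ℂ)⁻¹ - (z : ℂ)⁻¹ = 2 * Complex.I := by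
    rw [map_inv₀]
    field_simp
    linear_combination h
  have h3 := congrArg Complex.im h2
  simp only [Complex.sub_im, Complex.conj_im, Complex.mul_im, Complex.re_ofNat, Complex.I_im,
    Complex.im_ofNat, Complex.I_re] at h3
  apply Complex.ext
  · simp [resolventReal]
  · rw [Complex.sub_im, Complex.ofReal_im, Complex.I_im]
    linarith

/-- The `*`-homomorphism of the functional calculus of `Q`. -/
def calculusHom : BoundedBorel →⋆ₐ[ℂ] (M →L[ℂ] M) :=
  (extension M.resolventCalculus).comp (BoundedBorel.comp M.measurable_resolventReal)

theorem calculusHom_apply (f : BoundedBorel) (v : M) :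
    M.calculusHom f v =
      act M.resolventCalculus (BoundedBorel.comp M.measurable_resolventReal f) v := rfl

/-- The characteristic function of the point `0` of the spectrum of the resolvent. -/
def indicatorZero : BoundedMeasurable M.ResolventSpectrum :=
  ⟨{z : M.ResolventSpectrum | (z : ℂ) = 0}.indicator 1,
    measurable_one.indicator (measurableSet_eq_fun measurable_subtype_coe measurable_const), 1,
    fun z => by by_cases hz : z ∈ {z : M.ResolventSpectrum | (z : ℂ) = 0} <;> simp [hz]⟩

variable {M} in
theorem indicatorZero_of_eq {z : M.ResolventSpectrum} (hz : (z : ℂ) = 0) :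
    (M.indicatorZero : M.ResolventSpectrum → ℂ) z = 1 :=
  Set.indicator_of_mem (s := {z : M.ResolventSpectrum | (z : ℂ) = 0}) hz 1

variable {M} in
theorem indicatorZero_of_ne {z : M.ResolventSpectrum} (hz : (z : ℂ) ≠ 0) :
    (M.indicatorZero : M.ResolventSpectrum → ℂ) z = 0 :=
  Set.indicator_of_notMem (s := {z : M.ResolventSpectrum | (z : ℂ) = 0}) hz 1

/-- The point `0` stands for `x = ∞`, and `resolventReal` sends it to `0` only by the convention for
inverses. The convention is harmless: the operator below is annihilated by the resolvent, which is
injective. -/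
theorem act_indicatorZero (u : M) : act M.resolventCalculus M.indicatorZero u = 0 := by
  refine resolvent_injective I_im_ne_zero ?_
  rw [map_zero]
  refine (DFunLike.congr_fun M.resolventCalculus_coord _).symm.trans ?_
  rw [← act_ofContinuous_mul]
  have h : ofContinuous M.resolventCoord * M.indicatorZero = 0 := by
    apply Subtype.ext
    funext z
    change (z : ℂ) * (M.indicatorZero : M.ResolventSpectrum → ℂ) z = 0
    by_cases hz : (z : ℂ) = 0
    · rw [hz, zero_mul]
    · rw [indicatorZero_of_ne hz, mul_zero]
  rw [h]
  exact DFunLike.congr_fun (map_zero (extension M.resolventCalculus)) u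

theorem tendsto_calculusHom_operator (h : ℕ → BoundedBorel)
    (h1 : ∀ x : ℝ, Tendsto (fun n => (h n : ℝ → ℂ) x) atTop (𝓝 (x : ℂ)))
    (h2 : ∀ n x, ‖(h n : ℝ → ℂ) x‖ ≤ |x|) (v : M.Q.domain) :
    Tendsto (fun n => M.calculusHom (h n) v) atTop (𝓝 (M.Q v)) := by
  set u : M := M.Q v - Complex.I • (v : M) with hu
  have hv : M.resolvent I_im_ne_zero u = v :=
    resolvent_apply_of_mem_graph I_im_ne_zero (M.Q.mem_graph v)
  have hv' : act M.resolventCalculus (ofContinuous M.resolventCoord) u = v := by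
    rw [act_ofContinuous, resolventCalculus_coord, hv]
  -- With `v = R u`, one has `Q v = u + i R u`, the function `1 + i z`. At `z = 0` the approximants
  -- `hₙ(x) z` vanish while `1 + i z` is `1`; subtracting the indicator repairs this without
  -- changing the operator.
  have hQ : act M.resolventCalculus (1 + Complex.I • ofContinuous M.resolventCoord
      - M.indicatorZero) u = M.Q v := by
    rw [act_sub_left, act_add_left, act_smul_left, act_one, hv', act_indicatorZero, sub_zero, hu,
      sub_add_cancel]
  have hn : ∀ n, M.calculusHom (h n) v = act M.resolventCalculus
      (BoundedBorel.comp M.measurable_resolventReal (h n) * ofContinuous M.resolventCoord) u :=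
    fun n => by rw [act_mul, hv', calculusHom_apply]
  simp only [hn]
  rw [← hQ]
  refine tendsto_act_of_bounded _ u (fun z => ?_) ⟨1, fun n z => ?_⟩
  · change Tendsto (fun n => (h n : ℝ → ℂ) (M.resolventReal z) * (z : ℂ)) atTop
      (𝓝 (1 + Complex.I * (z : ℂ) - (M.indicatorZero : M.ResolventSpectrum → ℂ) z))
    by_cases hz : (z : ℂ) = 0
    · rw [indicatorZero_of_eq hz, hz]
      simp
    · rw [indicatorZero_of_ne hz, sub_zero]
      have h3 : 1 + Complex.I * (z : ℂ) = M.resolventReal z * z := by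
        have h4 := M.inv_eq_resolventReal_sub_I z hz
        rw [← mul_inv_cancel₀ hz, h4]
        ring
      rw [h3]
      exact (h1 _).mul_const _
  -- The growth `|hₙ(x)| ≤ |x|` is absorbed by the factor `z`, since `|x| ≤ 1 / |z|`.
  · change ‖(h n : ℝ → ℂ) (M.resolventReal z) * (z : ℂ)‖ ≤ 1
    rw [norm_mul]
    have h3 : |M.resolventReal z| ≤ ‖(z : ℂ)‖⁻¹ := by
      rw [← norm_inv]
      exact Complex.abs_re_le_norm _
    calc _ ≤ ‖(z : ℂ)‖⁻¹ * ‖(z : ℂ)‖ := by gcongr; exact (h2 n _).trans h3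
      _ ≤ 1 := inv_mul_le_one

/-- The spectral theorem: every self-adjoint operator has a bounded Borel functional calculus. -/
instance nonempty_borelCalculus : Nonempty (BorelCalculus M) :=
  ⟨{ hom := M.calculusHom
     tendsto_operator := M.tendsto_calculusHom_operator
     tendsto_strong := fun _ _ h1 ⟨C, hC⟩ v =>
      tendsto_act_of_bounded _ v (fun x => h1 (M.resolventReal x)) ⟨C, fun n _ => hC n _⟩ }⟩

/-- The Borel functional calculus of `Q`. -/
def calculus : BorelCalculus M := M.nonempty_borelCalculus.some

theorem applyBorel_eq (f : BoundedBorel) : M.applyBorel f = M.calculus.hom f := by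
  rw [applyBorel, dif_pos M.nonempty_borelCalculus, calculus]

end HilbertOperator

namespace HilbertOperator

/-! ### Integrals against spectral measures -/

variable (M : HilbertOperator.{u})

/-- The functional calculus as a `*`-homomorphism. -/
def borel : BoundedBorel →⋆ₐ[ℂ] (M →L[ℂ] M) := M.calculus.hom

theorem applyBorel_eq_borel (f : BoundedBorel) : M.applyBorel f = M.borel f := M.applyBorel_eq f

theorem tendsto_borel {h : ℕ → BoundedBorel} {k : BoundedBorel}
    (hk : ∀ x : ℝ, Tendsto (fun n => (h n : ℝ → ℂ) x) atTop (𝓝 ((k : ℝ → ℂ) x)))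
    (hb : ∃ C : ℝ, ∀ n x, ‖(h n : ℝ → ℂ) x‖ ≤ C) (v : M) :
    Tendsto (fun n => M.borel (h n) v) atTop (𝓝 (M.borel k v)) :=
  M.calculus.tendsto_strong h k hk hb v

theorem inner_borel_star (f : BoundedBorel) (v w : M) :
    ⟪M.borel (star f) v, w⟫_ℂ = ⟪v, M.borel f w⟫_ℂ := by
  rw [map_star, ContinuousLinearMap.star_eq_adjoint, ContinuousLinearMap.adjoint_inner_left]

theorem borel_mul_apply (f g : BoundedBorel) (v : M) :
    M.borel (f * g) v = M.borel f (M.borel g v) := by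
  rw [map_mul, mul_apply_eq_comp]

theorem inner_borel_borel (f g : BoundedBorel) (v w : M) :
    ⟪M.borel f v, M.borel g w⟫_ℂ = ⟪v, M.borel (star f * g) w⟫_ℂ := by
  rw [borel_mul_apply, ← inner_borel_star M (star f), star_star]

theorem borel_one_apply (v : M) : M.borel 1 v = v := by rw [map_one, one_apply_eq_self]

theorem inner_borel_indicator (Ω : Set ℝ) (hΩ : MeasurableSet Ω) (v : M) :
    ⟪v, M.borel (BoundedBorel.indicator Ω hΩ) v⟫_ℂ =
      (‖M.borel (BoundedBorel.indicator Ω hΩ) v‖ ^ 2 : ℝ) := by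
  have hχ : BoundedBorel.indicator Ω hΩ =
      star (BoundedBorel.indicator Ω hΩ) * BoundedBorel.indicator Ω hΩ := by
    apply Subtype.ext
    funext x
    by_cases hx : x ∈ Ω <;> simp [BoundedBorel.indicator, hx]
  conv_lhs => rw [hχ]
  rw [← inner_borel_borel, inner_self_eq_norm_sq_to_K]
  norm_cast

theorem spectralMeasure_apply (v : M) {Ω : Set ℝ} (hΩ : MeasurableSet Ω) :
    M.spectralMeasure v Ω =
      ENNReal.ofReal (‖M.borel (BoundedBorel.indicator Ω hΩ) v‖ ^ 2) := by
  rw [spectralMeasure, Measure.ofMeasurable_apply _ hΩ, spectralProjection, applyBorel_eq_borel,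
    inner_borel_indicator, Complex.ofReal_re]

instance (v : M) : IsFiniteMeasure (M.spectralMeasure v) :=
  ⟨by rw [spectralMeasure_apply M v MeasurableSet.univ]; exact ENNReal.ofReal_lt_top⟩

theorem inner_borel_indicator_eq_measure (Ω : Set ℝ) (hΩ : MeasurableSet Ω) (v : M) :
    ⟪v, M.borel (BoundedBorel.indicator Ω hΩ) v⟫_ℂ = ((M.spectralMeasure v).real Ω : ℂ) := by
  rw [inner_borel_indicator, measureReal_def, spectralMeasure_apply M v hΩ,
    ENNReal.toReal_ofReal (by positivity)]

/-- A simple function as a bounded Borel function. -/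
def _root_.BoundedBorel.ofSimpleFunc (s : SimpleFunc ℝ ℂ) : BoundedBorel :=
  ⟨s, s.measurable, s.exists_forall_norm_le⟩

theorem integrable_boundedBorel (f : BoundedBorel) (μ : Measure ℝ) [IsFiniteMeasure μ] :
    Integrable (f : ℝ → ℂ) μ := by
  obtain ⟨C, hC⟩ := f.2.2
  exact Integrable.of_bound f.2.1.aestronglyMeasurable C (Eventually.of_forall hC)

theorem inner_borel_ofSimpleFunc (s : SimpleFunc ℝ ℂ) (v : M) :
    ⟪v, M.borel (BoundedBorel.ofSimpleFunc s) v⟫_ℂ = ∫ x, s x ∂(M.spectralMeasure v) := by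
  induction s using SimpleFunc.induction with
  | @const c Ω hΩ =>
    have h : BoundedBorel.ofSimpleFunc (SimpleFunc.piecewise Ω hΩ (SimpleFunc.const ℝ c)
        (SimpleFunc.const ℝ 0)) = c • BoundedBorel.indicator Ω hΩ := by
      apply Subtype.ext
      funext x
      by_cases hx : x ∈ Ω <;> simp [BoundedBorel.indicator, BoundedBorel.ofSimpleFunc, hx]
    rw [h, map_smul, smul_apply, inner_smul_right, inner_borel_indicator_eq_measure]
    simp only [SimpleFunc.coe_piecewise, SimpleFunc.coe_const,
      Function.const_zero, Set.piecewise_eq_indicator]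
    rw [integral_indicator hΩ]
    simp [mul_comm]
  | @add f g _ hf hg =>
    have h : BoundedBorel.ofSimpleFunc (f + g) =
      BoundedBorel.ofSimpleFunc f + BoundedBorel.ofSimpleFunc g := rfl
    rw [h, map_add, add_apply, inner_add_right, hf, hg]
    exact (integral_add (integrable_boundedBorel (BoundedBorel.ofSimpleFunc f) _)
      (integrable_boundedBorel (BoundedBorel.ofSimpleFunc g) _)).symm

theorem inner_borel_eq_integral (f : BoundedBorel) (v : M) :
    ⟪v, M.borel f v⟫_ℂ = ∫ x, (f : ℝ → ℂ) x ∂(M.spectralMeasure v) := by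
  obtain ⟨C, hC⟩ := f.2.2
  have hm : StronglyMeasurable (f : ℝ → ℂ) := f.2.1.stronglyMeasurable
  have hC0 : 0 ≤ C := (norm_nonneg _).trans (hC 0)
  have h1 : ∀ x, Tendsto (fun n => hm.approxBounded C n x) atTop (𝓝 ((f : ℝ → ℂ) x)) :=
    fun x => hm.tendsto_approxBounded_of_norm_le (hC x)
  have h2 := (tendsto_const_nhds (x := v)).inner (𝕜 := ℂ) (M.tendsto_borel
    (h := fun n => BoundedBorel.ofSimpleFunc (hm.approxBounded C n)) h1
    ⟨C, fun n x => hm.norm_approxBounded_le hC0 n x⟩ v)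
  refine tendsto_nhds_unique h2 ?_
  simp only [inner_borel_ofSimpleFunc]
  exact tendsto_integral_of_dominated_convergence (fun _ => C)
    (fun n => (hm.approxBounded C n).aestronglyMeasurable) (integrable_const _)
    (fun n => Eventually.of_forall fun x => hm.norm_approxBounded_le hC0 n x)
    (Eventually.of_forall h1)

/-! ### The resolvent in the functional calculus -/

theorem ofReal_sub_ne_zero {z : ℂ} (hz : z.im ≠ 0) (x : ℝ) : (x : ℂ) - z ≠ 0 := fun h => by
  apply hz
  rw [← sub_eq_zero.1 h, Complex.ofReal_im]

theorem norm_inv_ofReal_sub_le {z : ℂ} (hz : z.im ≠ 0) (x : ℝ) :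
    ‖((x : ℂ) - z)⁻¹‖ ≤ |z.im|⁻¹ := by
  rw [norm_inv]
  refine inv_anti₀ (abs_pos.2 hz) ?_
  simpa using Complex.abs_im_le_norm ((x : ℂ) - z)

/-- The function `x ↦ 1 / (x - z)`. -/
def resolventFun {z : ℂ} (hz : z.im ≠ 0) : BoundedBorel :=
  ⟨fun x => ((x : ℂ) - z)⁻¹, (Complex.measurable_ofReal.sub_const z).inv, |z.im|⁻¹,
    norm_inv_ofReal_sub_le hz⟩

/-- The truncation of the identity function. -/
def truncation (n : ℕ) : BoundedBorel :=
  ⟨(Set.Icc (-n : ℝ) n).indicator fun x => (x : ℂ),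
    Complex.measurable_ofReal.indicator measurableSet_Icc, n, fun x => by
      by_cases hx : x ∈ Set.Icc (-n : ℝ) n
      · rw [Set.indicator_of_mem hx, Complex.norm_real]
        exact abs_le.2 hx
      · rw [Set.indicator_of_notMem hx, norm_zero]
        positivity⟩

theorem truncation_apply_of_le {n : ℕ} {x : ℝ} (h : |x| ≤ n) : (truncation n : ℝ → ℂ) x = x :=
  Set.indicator_of_mem (s := Set.Icc (-n : ℝ) n) (abs_le.1 h) _

theorem truncation_apply_of_lt {n : ℕ} {x : ℝ} (h : (n : ℝ) < |x|) : (truncation n : ℝ → ℂ) x = 0 :=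
  Set.indicator_of_notMem (s := Set.Icc (-n : ℝ) n) (fun hx => not_le.2 h (abs_le.2 hx)) _

theorem tendsto_truncation (x : ℝ) :
    Tendsto (fun n => (truncation n : ℝ → ℂ) x) atTop (𝓝 (x : ℂ)) := by
  refine tendsto_const_nhds.congr' ?_
  obtain ⟨N, hN⟩ := exists_nat_ge |x|
  filter_upwards [eventually_ge_atTop N] with n hn
  exact (truncation_apply_of_le (hN.trans (by exact_mod_cast hn))).symm

theorem norm_truncation_le (n : ℕ) (x : ℝ) : ‖(truncation n : ℝ → ℂ) x‖ ≤ |x| := by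
  rcases le_or_gt |x| n with h | h
  · rw [truncation_apply_of_le h, Complex.norm_real, Real.norm_eq_abs]
  · rw [truncation_apply_of_lt h, norm_zero]
    positivity

/-- The chosen calculus is known only through its two limit properties. They determine its value
here: in `(Q - z) R u = u` replace `Q` by truncations, and use that `(x - z)⁻¹ (tₙ(x) - z)` tends
boundedly to `1`. -/
theorem borel_resolventFun {z : ℂ} (hz : z.im ≠ 0) :
    M.borel (resolventFun hz) = M.resolvent hz := by
  ext u
  obtain ⟨v, hv, hQ⟩ := (LinearPMap.mem_graph_iff _).1 (resolvent_mem_graph hz u)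
  have h1 := M.calculus.tendsto_operator truncation tendsto_truncation norm_truncation_le v
  have h2 := ((M.borel (resolventFun hz)).continuous.tendsto _).comp
    (h1.sub_const (z • (v : M)))
  rw [hQ, hv, add_sub_cancel_right] at h2
  refine tendsto_nhds_unique h2 ?_
  have h3 : ∀ n, M.borel (resolventFun hz * (truncation n - z • 1)) (M.resolvent hz u) =
      M.borel (resolventFun hz) (M.calculus.hom (truncation n) (M.resolvent hz u) -
        z • (M.resolvent hz u)) := fun n => by
    rw [borel_mul_apply, map_sub, map_smul, map_one]
    rfl
  -- The product is `1` where `|x| ≤ n` and at most `‖z‖ / |Im z|` elsewhere; the bound is the sum.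
  have h4 := M.tendsto_borel (h := fun n => resolventFun hz * (truncation n - z • 1)) (k := 1)
    (fun x => ?_) ⟨1 + |z.im|⁻¹ * ‖z‖, fun n x => ?_⟩ (M.resolvent hz u)
  · rw [borel_one_apply] at h4
    simp only [h3] at h4
    exact h4
  · change Tendsto (fun n => ((x : ℂ) - z)⁻¹ * ((truncation n : ℝ → ℂ) x - z * 1)) atTop (𝓝 1)
    have h5 := ((tendsto_truncation x).sub_const z).const_mul ((x : ℂ) - z)⁻¹
    rw [inv_mul_cancel₀ (ofReal_sub_ne_zero hz x)] at h5
    simpa only [mul_one] using h5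
  · change ‖((x : ℂ) - z)⁻¹ * ((truncation n : ℝ → ℂ) x - z * 1)‖ ≤ _
    rw [mul_one]
    rcases le_or_gt |x| n with h | h
    · rw [truncation_apply_of_le h, inv_mul_cancel₀ (ofReal_sub_ne_zero hz x), norm_one]
      simp only [le_add_iff_nonneg_right]
      positivity
    · rw [truncation_apply_of_lt h, zero_sub, norm_mul, norm_neg]
      have := norm_inv_ofReal_sub_le hz x
      have : ‖((x : ℂ) - z)⁻¹‖ * ‖z‖ ≤ |z.im|⁻¹ * ‖z‖ := by gcongr
      linarith

/-! ### Embeddings intertwine the functional calculi -/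

variable {M} {M' : HilbertOperator.{u}} {j : M →ₗᵢ[ℂ] M'}

theorem IsKSubstructure.map_resolvent (hj : IsKSubstructure j) {z : ℂ} (hz : z.im ≠ 0) (u : M) :
    j (M.resolvent hz u) = M'.resolvent hz (j u) := by
  have h := resolvent_apply_of_mem_graph hz (hj _ _ (resolvent_mem_graph hz u))
  rw [← j.map_smul, ← j.map_sub, add_sub_cancel_right] at h
  exact h.symm

/-- A bounded continuous function as a bounded Borel function. -/
def _root_.BoundedBorel.ofContinuous : BoundedContinuousFunction ℝ ℂ →⋆ₐ[ℂ] BoundedBorel where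
  toFun g := ⟨g, g.continuous.measurable, ‖g‖, g.norm_coe_le_norm⟩
  map_one' := rfl
  map_mul' _ _ := rfl
  map_zero' := rfl
  map_add' _ _ := rfl
  commutes' _ := rfl
  map_star' _ := rfl

/-- The bounded Borel functions which an isometry intertwines, together with their conjugates. -/
def intertwined (j : M →ₗᵢ[ℂ] M') : StarSubalgebra ℂ BoundedBorel where
  carrier := {f | (∀ v, j (M.borel f v) = M'.borel f (j v)) ∧
    ∀ v, j (M.borel (star f) v) = M'.borel (star f) (j v)}
  mul_mem' := by
    rintro f g ⟨hf, hf'⟩ ⟨hg, hg'⟩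
    refine ⟨fun v => ?_, fun v => ?_⟩
    · rw [borel_mul_apply, borel_mul_apply, hf, hg]
    · rw [star_mul, borel_mul_apply, borel_mul_apply, hg', hf']
  add_mem' := by
    rintro f g ⟨hf, hf'⟩ ⟨hg, hg'⟩
    refine ⟨fun v => ?_, fun v => ?_⟩
    · rw [map_add, map_add, add_apply, add_apply, map_add, hf, hg]
    · rw [star_add, map_add, map_add, add_apply, add_apply, map_add, hf', hg']
  algebraMap_mem' r := by
    have h : ∀ (c : ℂ) (v : M), j (M.borel (algebraMap ℂ _ c) v) =
        M'.borel (algebraMap ℂ _ c) (j v) := fun c v => by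
      rw [AlgHomClass.commutes, AlgHomClass.commutes, Algebra.algebraMap_eq_smul_one,
        Algebra.algebraMap_eq_smul_one]
      simp
    refine ⟨h r, ?_⟩
    rw [← algebraMap_star_comm]
    exact h _
  star_mem' := by
    rintro f ⟨hf, hf'⟩
    exact ⟨hf', by rwa [star_star]⟩

theorem star_resolventFun {z w : ℂ} (hz : z.im ≠ 0) (hw : w.im ≠ 0) (h : (starRingEnd ℂ) z = w) :
    star (resolventFun hz) = resolventFun hw := by
  subst h
  apply Subtype.ext
  funext x
  change (starRingEnd ℂ) ((x : ℂ) - z)⁻¹ = ((x : ℂ) - (starRingEnd ℂ) z)⁻¹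
  simp

theorem IsKSubstructure.resolventFun_mem (hj : IsKSubstructure j) :
    resolventFun I_im_ne_zero ∈ intertwined j := by
  have h : ∀ {z : ℂ} (hz : z.im ≠ 0) (v : M),
      j (M.borel (resolventFun hz) v) = M'.borel (resolventFun hz) (j v) := fun hz v => by
    rw [borel_resolventFun, borel_resolventFun, hj.map_resolvent]
  refine ⟨h _, ?_⟩
  rw [star_resolventFun I_im_ne_zero neg_I_im_ne_zero Complex.conj_I]
  exact h _

/-- A finite Borel measure on the line is determined by its integrals over a `*`-algebra of bounded
continuous functions that separates points. The intertwined functions form such an algebra, as they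
include the injective function `1 / (x - i)`. -/
theorem IsKSubstructure.spectralMeasure_map (hj : IsKSubstructure j) (v : M) :
    M'.spectralMeasure (j v) = M.spectralMeasure v := by
  refine ext_of_forall_mem_subalgebra_integral_eq_of_polish (𝕜 := ℂ)
    (A := (intertwined j).comap BoundedBorel.ofContinuous) ?_ fun g hg => ?_
  · intro x y hxy
    let g : BoundedContinuousFunction ℝ ℂ := BoundedContinuousFunction.ofNormedAddCommGroup
      (fun x : ℝ => ((x : ℂ) - Complex.I)⁻¹)
      ((Complex.continuous_ofReal.sub continuous_const).inv₀ (ofReal_sub_ne_zero I_im_ne_zero))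
      |Complex.I.im|⁻¹ (norm_inv_ofReal_sub_le I_im_ne_zero)
    refine ⟨g, ⟨g.toContinuousMap, ⟨g, hj.resolventFun_mem, rfl⟩, rfl⟩, fun h => hxy ?_⟩
    have h' : ((x : ℂ) - Complex.I)⁻¹ = ((y : ℂ) - Complex.I)⁻¹ := h
    exact_mod_cast sub_left_inj.1 (inv_injective h')
  · have h1 := inner_borel_eq_integral M' (BoundedBorel.ofContinuous g) (j v)
    have h2 := inner_borel_eq_integral M (BoundedBorel.ofContinuous g) v
    have h3 : j (M.borel (BoundedBorel.ofContinuous g) v) =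
      M'.borel (BoundedBorel.ofContinuous g) (j v) := hg.1 v
    rw [← h3, j.inner_map_map, h2] at h1
    exact h1.symm

/-- An embedding intertwines the functional calculi. -/
theorem IsKSubstructure.map_borel (hj : IsKSubstructure j) (f : BoundedBorel) (v : M) :
    j (M.borel f v) = M'.borel f (j v) := by
  have h1 : ∀ (f : BoundedBorel) (v : M), ⟪j v, M'.borel f (j v)⟫_ℂ = ⟪v, M.borel f v⟫_ℂ :=
    fun f v => by
      rw [inner_borel_eq_integral, inner_borel_eq_integral, hj.spectralMeasure_map]
  -- By polarization, equal diagonal values show that `f(Q)` is the compression of `f(Q')`.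
  have h2 : (ContinuousLinearMap.adjoint j.toContinuousLinearMap ∘L M'.borel f ∘L
      j.toContinuousLinearMap : M →ₗ[ℂ] M) = (M.borel f : M →ₗ[ℂ] M) := by
    refine (ext_inner_map _ _).1 fun x => ?_
    change ⟪ContinuousLinearMap.adjoint j.toContinuousLinearMap (M'.borel f (j x)), x⟫_ℂ =
      ⟪M.borel f x, x⟫_ℂ
    rw [ContinuousLinearMap.adjoint_inner_left, ← inner_conj_symm, ← inner_conj_symm (M.borel f x)]
    exact congrArg _ (h1 f x)
  have h3 : ⟪j (M.borel f v), M'.borel f (j v)⟫_ℂ = ⟪M.borel f v, M.borel f v⟫_ℂ :=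
    calc _ = ⟪M.borel f v, ContinuousLinearMap.adjoint j.toContinuousLinearMap
            (M'.borel f (j v))⟫_ℂ := (ContinuousLinearMap.adjoint_inner_right _ _ _).symm
      _ = _ := congrArg _ (LinearMap.congr_fun h2 v)
  -- The compression alone does not give invariance of the image. Applying `h1` to `|f|²` equates
  -- the norms, and the square of the difference then expands to zero.
  have h4 : ‖M'.borel f (j v)‖ ^ 2 = ‖M.borel f v‖ ^ 2 := by
    have h := h1 (star f * f) v
    rw [← inner_borel_borel, ← inner_borel_borel, inner_self_eq_norm_sq_to_K,
      inner_self_eq_norm_sq_to_K] at h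
    exact_mod_cast h
  rw [← sub_eq_zero, ← norm_eq_zero, ← sq_eq_zero_iff, @norm_sub_sq ℂ, h3, h4, j.norm_map,
    inner_self_eq_norm_sq]
  ring

end HilbertOperator

namespace HilbertOperator

/-! ### Embeddings and reducing subspaces -/

variable {M M' : HilbertOperator.{u}} {j : M →ₗᵢ[ℂ] M'}

/-- The adjoint of an isometry. -/
def retraction (j : M →ₗᵢ[ℂ] M') : M' →L[ℂ] M :=
  ContinuousLinearMap.adjoint j.toContinuousLinearMap

theorem inner_retraction_right (j : M →ₗᵢ[ℂ] M') (x : M) (y : M') :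
    ⟪x, retraction j y⟫_ℂ = ⟪j x, y⟫_ℂ :=
  ContinuousLinearMap.adjoint_inner_right _ _ _

@[simp]
theorem retraction_apply_self (j : M →ₗᵢ[ℂ] M') (x : M) : retraction j (j x) = x :=
  ext_inner_left ℂ fun v => by rw [inner_retraction_right, j.inner_map_map]

theorem norm_retraction_le (j : M →ₗᵢ[ℂ] M') (y : M') : ‖retraction j y‖ ≤ ‖y‖ := by
  have h1 : ‖retraction j y‖ * ‖retraction j y‖ ≤ ‖retraction j y‖ * ‖y‖ := by
    calc ‖retraction j y‖ * ‖retraction j y‖ = ‖⟪j (retraction j y), y⟫_ℂ‖ := by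
          rw [← inner_retraction_right, inner_self_eq_norm_sq_to_K]
          simp [sq]
      _ ≤ ‖j (retraction j y)‖ * ‖y‖ := norm_inner_le_norm _ _
      _ = _ := by rw [j.norm_map]
  rcases (norm_nonneg (retraction j y)).eq_or_lt with h0 | h0
  · rw [← h0]; exact norm_nonneg _
  · exact le_of_mul_le_mul_left h1 h0

/-- The image of an embedding reduces the operator. -/
theorem IsKSubstructure.retraction_mem_graph (hj : IsKSubstructure j) {p : M' × M'}
    (h : p ∈ M'.Q.graph) : (retraction j p.1, retraction j p.2) ∈ M.Q.graph := by
  refine (M.mem_graph_iff_inner _).2 fun q hq => ?_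
  rw [inner_retraction_right, inner_retraction_right]
  exact M'.inner_symm_of_mem_graph h (hj q.1 q.2 hq)

theorem IsKSubstructure.comp {N : HilbertOperator.{u}} {k : M' →ₗᵢ[ℂ] N} (hk : IsKSubstructure k)
    (hj : IsKSubstructure j) : IsKSubstructure (k.comp j) :=
  fun x y h => hk _ _ (hj x y h)

theorem norm_toLp_prod_le {E F : Type*} [NormedAddCommGroup E] [NormedAddCommGroup F] {a b : E}
    {c d : F} (h1 : ‖a‖ ≤ ‖c‖) (h2 : ‖b‖ ≤ ‖d‖) :
    ‖WithLp.toLp 2 (a, b)‖ ≤ ‖WithLp.toLp 2 (c, d)‖ := by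
  rw [WithLp.prod_norm_eq_of_L2, WithLp.prod_norm_eq_of_L2]
  exact Real.sqrt_le_sqrt (add_le_add (pow_le_pow_left₀ (norm_nonneg _) h1 2)
    (pow_le_pow_left₀ (norm_nonneg _) h2 2))

/-- The inclusion of a substructure is an embedding. -/
theorem IsKSubstructure.isKEmbedding (hj : IsKSubstructure j) : IsKEmbedding j := by
  refine ⟨fun v w => le_antisymm ?_ ?_, hj⟩
  · rw [Γ, Γ]
    refine (Metric.le_infDist (Set.Nonempty.image _ ⟨0, M.Q.graph.zero_mem⟩)).2 ?_
    rintro _ ⟨⟨x, y⟩, h, rfl⟩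
    refine (Metric.infDist_le_dist_of_mem (Set.mem_image_of_mem _ (hj x y h))).trans ?_
    rw [dist_eq_norm, dist_eq_norm, ← WithLp.toLp_sub, ← WithLp.toLp_sub]
    refine norm_toLp_prod_le ?_ ?_
    · rw [← map_sub, j.norm_map]
    · rw [← map_sub, j.norm_map]
  -- For this inequality `retraction j` is a contraction that maps the graph of `M'` to that of `M`
  -- and undoes `j` on `v` and `w`.
  · rw [Γ, Γ]
    refine (Metric.le_infDist (Set.Nonempty.image _ ⟨0, M'.Q.graph.zero_mem⟩)).2 ?_
    rintro _ ⟨p, h, rfl⟩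
    refine (Metric.infDist_le_dist_of_mem (Set.mem_image_of_mem _
      (hj.retraction_mem_graph h))).trans ?_
    rw [dist_eq_norm, dist_eq_norm, ← WithLp.toLp_sub, ← WithLp.toLp_sub]
    refine norm_toLp_prod_le ?_ ?_
    · refine le_trans (le_of_eq ?_) (norm_retraction_le j _)
      simp
    · refine le_trans (le_of_eq ?_) (norm_retraction_le j _)
      simp

/-! ### Spectrum and essential spectrum of substructures and of sums -/

/-- A lower bound already contains injectivity. In this form both conditions pass through isometries
and contractions that respect graphs. -/
theorem notMem_spectrum_iff {z : ℂ} : z ∉ M.spectrum ↔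
    (∃ C : ℝ, 0 ≤ C ∧ ∀ p ∈ M.Q.graph, ‖p.1‖ ≤ C * ‖p.2 - z • p.1‖) ∧
      ∀ u : M, ∀ ε > 0, ∃ p ∈ M.Q.graph, ‖u - (p.2 - z • p.1)‖ < ε := by
  have hdense : DenseRange (fun v : M.Q.domain => M.Q v - z • (v : M)) ↔
      ∀ u : M, ∀ ε > 0, ∃ p ∈ M.Q.graph, ‖u - (p.2 - z • p.1)‖ < ε := by
    rw [DenseRange, Metric.dense_iff]
    refine forall_congr' fun u => forall_congr' fun ε => forall_congr' fun _ => ?_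
    constructor
    · rintro ⟨_, h, v, rfl⟩
      exact ⟨_, M.Q.mem_graph v, by rwa [← dist_eq_norm, dist_comm]⟩
    · rintro ⟨⟨x, y⟩, h, hp⟩
      obtain ⟨v, rfl, rfl⟩ := (LinearPMap.mem_graph_iff _).1 h
      exact ⟨_, by rwa [Metric.mem_ball, dist_comm, dist_eq_norm], v, rfl⟩
  rw [← hdense, spectrum, Set.mem_union, Set.mem_union, not_or, not_or]
  simp only [pointSpectrum, continuousSpectrum, residualSpectrum, Set.mem_ofPred_eq, not_not]
  constructor
  · rintro ⟨⟨hinj, hc⟩, hd⟩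
    have : ∃ C : ℝ, ∀ v : M.Q.domain, ‖(v : M)‖ ≤ C * ‖M.Q v - z • (v : M)‖ := by
      by_contra hC
      exact hc ⟨hinj, hd, hC⟩
    obtain ⟨C, hC⟩ := this
    refine ⟨⟨|C|, abs_nonneg C, ?_⟩, hd⟩
    rintro ⟨x, y⟩ h
    obtain ⟨v, rfl, rfl⟩ := (LinearPMap.mem_graph_iff _).1 h
    exact (hC v).trans (mul_le_mul_of_nonneg_right (le_abs_self C) (norm_nonneg _))
  · rintro ⟨⟨C, -, hC⟩, hd⟩
    refine ⟨⟨fun v w hvw => ?_, fun h => h.2.2 ⟨C, fun v => hC _ (M.Q.mem_graph v)⟩⟩, hd⟩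
    have h := hC _ (M.Q.mem_graph (v - w))
    have h0 : M.Q (v - w) - z • ((v - w : M.Q.domain) : M) = 0 := by
      rw [LinearPMap.map_sub, AddSubgroupClass.coe_sub, smul_sub, sub_sub_sub_comm]
      exact sub_eq_zero.2 hvw
    rw [h0, norm_zero, mul_zero, norm_le_zero_iff] at h
    exact sub_eq_zero.1 (Subtype.ext h)

theorem notMem_essentialSpectrum_iff {z : ℂ} : z ∉ M.essentialSpectrum ↔
    ∃ S K : M →L[ℂ] M, IsCompactOperator K ∧ ∀ v, (S v, v + K v + z • S v) ∈ M.Q.graph := by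
  have hgraph : ∀ (S K : M →L[ℂ] M) (v : M),
      (∃ h : S v ∈ M.Q.domain, M.Q ⟨S v, h⟩ - z • S v = v + K v) ↔
        (S v, v + K v + z • S v) ∈ M.Q.graph := fun S K v => by
    constructor
    · rintro ⟨h, he⟩
      rw [← sub_eq_iff_eq_add.1 he]
      exact M.Q.mem_graph ⟨S v, h⟩
    · intro h
      obtain ⟨w, hw, hw'⟩ := (LinearPMap.mem_graph_iff _).1 h
      have hS : S v ∈ M.Q.domain := LinearPMap.mem_domain_of_mem_graph h
      have : w = ⟨S v, hS⟩ := Subtype.ext hw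
      rw [this] at hw'
      exact ⟨hS, by rw [hw', add_sub_cancel_right]⟩
  simp only [essentialSpectrum, Set.mem_ofPred_eq, hgraph]
  push Not
  rfl

/-- The lower bound is restricted along `j`; approximate solutions in `M'` are pulled back by
`retraction j`. -/
theorem IsKSubstructure.spectrum_subset (hj : IsKSubstructure j) : M.spectrum ⊆ M'.spectrum := by
  intro z hz
  contrapose! hz
  obtain ⟨⟨C, hC0, hC⟩, hd⟩ := notMem_spectrum_iff.1 hz
  refine notMem_spectrum_iff.2 ⟨⟨C, hC0, fun p hp => ?_⟩, fun u ε hε => ?_⟩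
  · have h := hC _ (hj p.1 p.2 hp)
    rwa [← j.map_smul, ← j.map_sub, j.norm_map, j.norm_map] at h
  · obtain ⟨p, hp, h⟩ := hd (j u) ε hε
    refine ⟨_, hj.retraction_mem_graph hp, lt_of_le_of_lt (le_of_eq ?_)
      ((norm_retraction_le j _).trans_lt h)⟩
    simp

theorem IsKSubstructure.essentialSpectrum_subset (hj : IsKSubstructure j) :
    M.essentialSpectrum ⊆ M'.essentialSpectrum := by
  intro z hz
  contrapose! hz
  obtain ⟨S, K, hK, h⟩ := notMem_essentialSpectrum_iff.1 hz
  refine notMem_essentialSpectrum_iff.2 ⟨retraction j ∘L S ∘L j.toContinuousLinearMap,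
    retraction j ∘L K ∘L j.toContinuousLinearMap,
    (hK.comp_clm j.toContinuousLinearMap).clm_comp (retraction j), fun v => ?_⟩
  simpa using hj.retraction_mem_graph (h (j v))

variable {N : HilbertOperator.{u}} {i : M →ₗᵢ[ℂ] N} {i' : M' →ₗᵢ[ℂ] N}

theorem spectrum_subset_union (hi : IsKSubstructure i) (hi' : IsKSubstructure i')
    (hs : ∀ x, i (retraction i x) + i' (retraction i' x) = x) :
    N.spectrum ⊆ M.spectrum ∪ M'.spectrum := by
  intro z hz
  contrapose! hz
  rw [Set.mem_union, not_or] at hz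
  obtain ⟨⟨C, hC0, hC⟩, hd⟩ := notMem_spectrum_iff.1 hz.1
  obtain ⟨⟨C', hC0', hC'⟩, hd'⟩ := notMem_spectrum_iff.1 hz.2
  refine notMem_spectrum_iff.2 ⟨⟨C + C', add_nonneg hC0 hC0', fun p hp => ?_⟩, fun u ε hε => ?_⟩
  · have h1 := hC _ (hi.retraction_mem_graph hp)
    have h2 := hC' _ (hi'.retraction_mem_graph hp)
    simp only [← map_smul, ← map_sub] at h1 h2
    have h3 := norm_retraction_le i (p.2 - z • p.1)
    have h4 := norm_retraction_le i' (p.2 - z • p.1)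
    calc ‖p.1‖ = ‖i (retraction i p.1) + i' (retraction i' p.1)‖ := by rw [hs]
      _ ≤ ‖retraction i p.1‖ + ‖retraction i' p.1‖ := by
          refine (norm_add_le _ _).trans ?_
          rw [i.norm_map, i'.norm_map]
      _ ≤ C * ‖p.2 - z • p.1‖ + C' * ‖p.2 - z • p.1‖ :=
          add_le_add (h1.trans (mul_le_mul_of_nonneg_left h3 hC0))
            (h2.trans (mul_le_mul_of_nonneg_left h4 hC0'))
      _ = _ := by ring
  · obtain ⟨p, hp, h⟩ := hd (retraction i u) (ε / 2) (half_pos hε)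
    obtain ⟨q, hq, h'⟩ := hd' (retraction i' u) (ε / 2) (half_pos hε)
    refine ⟨_, N.Q.graph.add_mem (hi p.1 p.2 hp) (hi' q.1 q.2 hq), ?_⟩
    have h3 : u - (i p.2 + i' q.2 - z • (i p.1 + i' q.1)) =
        i (retraction i u - (p.2 - z • p.1)) + i' (retraction i' u - (q.2 - z • q.1)) := by
      conv_lhs => rw [← hs u]
      simp only [map_sub, map_smul, smul_add]
      abel
    change ‖u - (i p.2 + i' q.2 - z • (i p.1 + i' q.1))‖ < ε
    rw [h3]
    refine (norm_add_le _ _).trans_lt ?_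
    rw [i.norm_map, i'.norm_map]
    linarith

theorem essentialSpectrum_subset_union (hi : IsKSubstructure i) (hi' : IsKSubstructure i')
    (hs : ∀ x, i (retraction i x) + i' (retraction i' x) = x) :
    N.essentialSpectrum ⊆ M.essentialSpectrum ∪ M'.essentialSpectrum := by
  intro z hz
  contrapose! hz
  rw [Set.mem_union, not_or] at hz
  obtain ⟨S, K, hK, h⟩ := notMem_essentialSpectrum_iff.1 hz.1
  obtain ⟨S', K', hK', h'⟩ := notMem_essentialSpectrum_iff.1 hz.2
  refine notMem_essentialSpectrum_iff.2
    ⟨i.toContinuousLinearMap ∘L S ∘L retraction i + i'.toContinuousLinearMap ∘L S' ∘L retraction i',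
    i.toContinuousLinearMap ∘L K ∘L retraction i + i'.toContinuousLinearMap ∘L K' ∘L retraction i',
    ((hK.comp_clm (retraction i)).clm_comp i.toContinuousLinearMap).add
      ((hK'.comp_clm (retraction i')).clm_comp i'.toContinuousLinearMap), fun v => ?_⟩
  have h1 := N.Q.graph.add_mem (hi _ _ (h (retraction i v))) (hi' _ _ (h' (retraction i' v)))
  have h2 : (i (retraction i v + K (retraction i v) + z • S (retraction i v)) +
      i' (retraction i' v + K' (retraction i' v) + z • S' (retraction i' v))) =
      (i (retraction i v) + i' (retraction i' v)) +
        (i (K (retraction i v)) + i' (K' (retraction i' v))) +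
        z • (i (S (retraction i v)) + i' (S' (retraction i' v))) := by
    simp only [map_add, map_smul, smul_add]
    abel
  rw [Prod.mk_add_mk, h2, hs] at h1
  exact h1

/-! ### Eigenspaces -/

theorem mem_eigenspace_iff {z : ℂ} {x : M} : x ∈ M.eigenspace z ↔ (x, z • x) ∈ M.Q.graph := Iff.rfl

theorem isClosed_eigenspace (z : ℂ) : IsClosed (M.eigenspace z : Set M) :=
  M.isClosed_graph.preimage (f := fun x : M => (x, z • x)) (by fun_prop)

theorem eigenspace_eq_bot {z : ℂ} (hz : z.im ≠ 0) : M.eigenspace z = ⊥ := by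
  refine (Submodule.eq_bot_iff _).2 fun x hx => ?_
  exact M.eq_of_mem_graph hz (mem_eigenspace_iff.1 hx) M.Q.graph.zero_mem (by simp)

/-- For real `z` the range of `Q - z`, hence that of `1 + K`, is orthogonal to the eigenspace. So
the compression of `-K` to the eigenspace is the identity, and a compact identity forces finite
dimension. -/
theorem finiteDimensional_eigenspace {z : ℂ} (hz : z ∉ M.essentialSpectrum) :
    FiniteDimensional ℂ (M.eigenspace z) := by
  by_cases him : z.im = 0
  swap
  · rw [eigenspace_eq_bot him]
    infer_instance
  obtain ⟨S, K, hK, h⟩ := notMem_essentialSpectrum_iff.1 hz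
  have : CompleteSpace (M.eigenspace z) := (isClosed_eigenspace z).completeSpace_coe
  have h1 : ∀ x ∈ M.eigenspace z, ∀ v : M, ⟪x, v + K v⟫_ℂ = 0 := fun x hx v => by
    have h2 := M.inner_symm_of_mem_graph (h v) (mem_eigenspace_iff.1 hx)
    simp only at h2
    rw [inner_add_right, inner_smul_left, inner_smul_right, Complex.conj_eq_iff_im.2 him] at h2
    exact right_eq_add.1 h2
  let P := (M.eigenspace z).orthogonalProjectionOnto
  have h3 : ∀ x : M.eigenspace z, -P (K x) = x := fun x => by
    refine ext_inner_left ℂ fun w => ?_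
    have h4 := h1 w w.2 x
    rw [inner_add_right, add_eq_zero_iff_eq_neg] at h4
    rw [inner_neg_right, Submodule.inner_orthogonalProjectionOnto_eq_of_mem_left, ← h4]
    rfl
  have h5 : IsCompactOperator (id : M.eigenspace z → M.eigenspace z) := by
    have h6 := ((hK.comp_clm (M.eigenspace z).subtypeL).clm_comp P).neg
    have h7 : -(P ∘ K ∘ (M.eigenspace z).subtypeL) = id := funext h3
    rwa [h7] at h6
  exact FiniteDimensional.of_isCompactOperator_id (𝕜 := ℂ) h5

theorem IsKSubstructure.map_eigenspace_le (hj : IsKSubstructure j) (z : ℂ) :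
    (M.eigenspace z).map (j.toLinearMap) ≤ M'.eigenspace z := by
  rintro _ ⟨x, hx, rfl⟩
  have h := hj _ _ (mem_eigenspace_iff.1 hx)
  rw [j.map_smul] at h
  exact h

theorem rank_map_eigenspace (j : M →ₗᵢ[ℂ] M') (z : ℂ) :
    Module.rank ℂ ((M.eigenspace z).map j.toLinearMap) = Module.rank ℂ (M.eigenspace z) :=
  (Submodule.equivMapOfInjective j.toLinearMap j.injective (M.eigenspace z)).rank_eq.symm

/-- Equal ranks give equality only because the eigenspace is finite dimensional off the essential
spectrum. -/
theorem IsKSubstructure.map_eigenspace_eq (hj : IsKSubstructure j) {z : ℂ}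
    (hz : z ∉ M'.essentialSpectrum)
    (hr : Module.rank ℂ (M.eigenspace z) = Module.rank ℂ (M'.eigenspace z)) :
    (M.eigenspace z).map j.toLinearMap = M'.eigenspace z := by
  have := finiteDimensional_eigenspace hz
  refine Submodule.eq_of_le_of_finrank_eq (hj.map_eigenspace_le z) ?_
  rw [Module.finrank, Module.finrank, rank_map_eigenspace, hr]

theorem retraction_mem_eigenspace (hj : IsKSubstructure j) {z : ℂ} {x : M'}
    (hx : x ∈ M'.eigenspace z) : retraction j x ∈ M.eigenspace z := by
  have h := hj.retraction_mem_graph (mem_eigenspace_iff.1 hx)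
  simp only [map_smul] at h
  exact h

/-- If `M₁ ⊕ R` is formed with a part `R` of `M₂` which is orthogonal to a member of the class, then
`M₁ ⊕ R` is a member of the class. -/
theorem mem_structureClass_of_sum {H M₀ M₁ M₂ R N : HilbertOperator.{u}}
    (h₀ : M₀ ∈ H.structureClass) (h₁ : M₁ ∈ H.structureClass) (h₂ : M₂ ∈ H.structureClass)
    {j : M₀ →ₗᵢ[ℂ] M₂} (hj : IsKSubstructure j) {k : R →ₗᵢ[ℂ] M₂} (hk : IsKSubstructure k)
    (hjk : ∀ r a, ⟪k r, j a⟫_ℂ = 0) {i : M₁ →ₗᵢ[ℂ] N} (hi : IsKSubstructure i)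
    {i' : R →ₗᵢ[ℂ] N} (hi' : IsKSubstructure i')
    (hs : ∀ x, i (retraction i x) + i' (retraction i' x) = x) : N ∈ H.structureClass := by
  obtain ⟨hσ₀, hε₀, hr₀⟩ := h₀
  obtain ⟨hσ₁, hε₁, hr₁⟩ := h₁
  obtain ⟨hσ₂, hε₂, hr₂⟩ := h₂
  have hσ : N.spectrum = H.spectrum := by
    refine subset_antisymm ((spectrum_subset_union hi hi' hs).trans
      (Set.union_subset hσ₁.subset ?_))
      (hσ₁ ▸ hi.spectrum_subset)
    exact hσ₂ ▸ hk.spectrum_subset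
  have hε : N.essentialSpectrum = H.essentialSpectrum := by
    refine subset_antisymm ((essentialSpectrum_subset_union hi hi' hs).trans
      (Set.union_subset hε₁.subset ?_)) (hε₁ ▸ hi.essentialSpectrum_subset)
    exact hε₂ ▸ hk.essentialSpectrum_subset
  refine ⟨hσ, hε, fun z hz => ?_⟩
  rw [hσ, hε] at hz
  -- The eigenspace of `M₂` is the image of that of `M₀`, so `k r` equals some `j a` and is
  -- orthogonal to itself.
  have hR : R.eigenspace z = ⊥ := by
    refine (Submodule.eq_bot_iff _).2 fun r hr => ?_
    have h1 : k r ∈ (M₀.eigenspace z).map j.toLinearMap := by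
      rw [hj.map_eigenspace_eq (hε₂ ▸ hz.2) ((hr₀ z (by rw [hσ₀, hε₀]; exact hz)).trans
        (hr₂ z (by rw [hσ₂, hε₂]; exact hz)).symm)]
      exact hk.map_eigenspace_le z ⟨r, hr, rfl⟩
    obtain ⟨a, -, ha⟩ := h1
    have h2 := hjk r a
    have ha' : j a = k r := ha
    rw [ha', k.inner_map_map, inner_self_eq_zero] at h2
    exact h2
  have hN : N.eigenspace z = (M₁.eigenspace z).map i.toLinearMap := by
    refine le_antisymm (fun x hx => ?_) (hi.map_eigenspace_le z)
    have h1 : retraction i' x = 0 := by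
      have := retraction_mem_eigenspace hi' hx
      rwa [hR, Submodule.mem_bot] at this
    refine ⟨retraction i x, retraction_mem_eigenspace hi hx, ?_⟩
    have h2 := hs x
    rw [h1, map_zero, add_zero] at h2
    exact h2
  rw [hN, rank_map_eigenspace]
  exact hr₁ z (by rw [hσ₁, hε₁]; exact hz)

/-! ### Direct sums and restrictions -/

/-- The graph of the direct sum of two operators. -/
def prodGraph (M M' : HilbertOperator.{u}) :
    Submodule ℂ (WithLp 2 (M × M') × WithLp 2 (M × M')) where
  carrier := {p | (p.1.fst, p.2.fst) ∈ M.Q.graph ∧ (p.1.snd, p.2.snd) ∈ M'.Q.graph}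
  add_mem' := fun h h' => ⟨M.Q.graph.add_mem h.1 h'.1, M'.Q.graph.add_mem h.2 h'.2⟩
  zero_mem' := ⟨M.Q.graph.zero_mem, M'.Q.graph.zero_mem⟩
  smul_mem' := fun c _ h => ⟨M.Q.graph.smul_mem c h.1, M'.Q.graph.smul_mem c h.2⟩

theorem mem_prodGraph_iff_inner (M M' : HilbertOperator.{u})
    (p : WithLp 2 (M × M') × WithLp 2 (M × M')) :
    p ∈ prodGraph M M' ↔ ∀ q ∈ prodGraph M M', ⟪q.2, p.1⟫_ℂ = ⟪q.1, p.2⟫_ℂ := by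
  constructor
  · intro hp q hq
    rw [WithLp.prod_inner_apply, WithLp.prod_inner_apply]
    exact congrArg₂ (· + ·) (M.inner_symm_of_mem_graph hp.1 hq.1)
      (M'.inner_symm_of_mem_graph hp.2 hq.2)
  · intro h
    refine ⟨(M.mem_graph_iff_inner _).2 fun q hq => ?_, (M'.mem_graph_iff_inner _).2 fun q hq => ?_⟩
    · have := h (WithLp.toLp 2 (q.1, 0), WithLp.toLp 2 (q.2, 0)) ⟨hq, M'.Q.graph.zero_mem⟩
      simpa [WithLp.prod_inner_apply] using this
    · have := h (WithLp.toLp 2 (0, q.1), WithLp.toLp 2 (0, q.2)) ⟨M.Q.graph.zero_mem, hq⟩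
      simpa [WithLp.prod_inner_apply] using this

theorem prodGraph_zero (M M' : HilbertOperator.{u}) (y : WithLp 2 (M × M'))
    (h : (0, y) ∈ prodGraph M M') : y = 0 := by
  have h1 : y.fst = 0 := M.Q.graph_fst_eq_zero_snd h.1 rfl
  have h2 : y.snd = 0 := M'.Q.graph_fst_eq_zero_snd h.2 rfl
  exact WithLp.ofLp_injective 2 (Prod.ext h1 h2)

/-- The direct sum of two self-adjoint operators. -/
def prod (M M' : HilbertOperator.{u}) : HilbertOperator.{u} :=
  ofGraph (prodGraph M M') (mem_prodGraph_iff_inner M M') (prodGraph_zero M M')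

theorem mem_graph_prod {x y : WithLp 2 (M × M')} :
    ((x, y) : M.prod M' × M.prod M') ∈ (M.prod M').Q.graph ↔
      (x.fst, y.fst) ∈ M.Q.graph ∧ (x.snd, y.snd) ∈ M'.Q.graph :=
  SetLike.ext_iff.1 (graph_ofGraph _ (mem_prodGraph_iff_inner M M') (prodGraph_zero M M')) (x, y)

/-- The pair of an isometry to the first summand and one to the second, as a map to the sum. -/
def prodIsometry {E : Type*} [NormedAddCommGroup E] [NormedSpace ℂ E] (a : E →ₗ[ℂ] M)
    (b : E →ₗ[ℂ] M') (h : ∀ x, ‖a x‖ ^ 2 + ‖b x‖ ^ 2 = ‖x‖ ^ 2) : E →ₗᵢ[ℂ] M.prod M' where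
  toFun x := (WithLp.toLp 2 (a x, b x) : WithLp 2 (M × M'))
  map_add' x y := by rw [map_add, map_add]; rfl
  map_smul' c x := by rw [map_smul, map_smul]; rfl
  norm_map' x := by
    refine (pow_left_inj₀ (norm_nonneg _) (norm_nonneg _) two_ne_zero).1 ?_
    rw [← h x]
    exact WithLp.prod_norm_sq_eq_of_L2 _

/-- The inclusion of the first summand. -/
def inl (M M' : HilbertOperator.{u}) : M →ₗᵢ[ℂ] M.prod M' :=
  prodIsometry LinearMap.id 0 (by simp)

/-- The inclusion of the second summand. -/
def inr (M M' : HilbertOperator.{u}) : M' →ₗᵢ[ℂ] M.prod M' :=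
  prodIsometry 0 LinearMap.id (by simp)

theorem isKSubstructure_inl (M M' : HilbertOperator.{u}) : IsKSubstructure (inl M M') :=
  fun _ _ h => mem_graph_prod.2 ⟨h, M'.Q.graph.zero_mem⟩

theorem isKSubstructure_inr (M M' : HilbertOperator.{u}) : IsKSubstructure (inr M M') :=
  fun _ _ h => mem_graph_prod.2 ⟨M.Q.graph.zero_mem, h⟩

theorem inl_add_inr (M M' : HilbertOperator.{u}) (x : M.prod M') :
    inl M M' (retraction (inl M M') x) + inr M M' (retraction (inr M M') x) = x := by
  have h1 : retraction (inl M M') x = WithLp.fst (p := 2) (α := M) (β := M') x := by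
    refine ext_inner_left ℂ fun v => ?_
    rw [inner_retraction_right]
    refine (WithLp.prod_inner_apply _ _).trans ?_
    exact (congrArg _ (inner_zero_left _)).trans (add_zero _)
  have h2 : retraction (inr M M') x = WithLp.snd (p := 2) (α := M) (β := M') x := by
    refine ext_inner_left ℂ fun v => ?_
    rw [inner_retraction_right]
    refine (WithLp.prod_inner_apply _ _).trans ?_
    exact (congrArg (· + _) (inner_zero_left _)).trans (zero_add _)
  rw [h1, h2]
  refine WithLp.ofLp_injective 2 (Prod.ext ?_ ?_)
  · exact add_zero _
  · exact zero_add _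

/-- The restriction of an operator to a reducing closed subspace. -/
def restrict (M : HilbertOperator.{u}) (U : Submodule ℂ M) [CompleteSpace U]
    (hU : ∀ p ∈ M.Q.graph, (U.starProjection p.1, U.starProjection p.2) ∈ M.Q.graph) :
    HilbertOperator.{u} :=
  ofGraph (E := U) (M.Q.graph.comap (U.subtype.prodMap U.subtype))
    (fun p => by
      rw [Submodule.mem_comap, mem_graph_iff_inner]
      refine ⟨fun h q hq => h _ hq, fun h q hq => ?_⟩
      -- A test pair from the whole graph may be replaced by its projection to `U`, since inner
      -- products with vectors of `U` do not change.
      have h1 := h (U.orthogonalProjectionOnto q.1, U.orthogonalProjectionOnto q.2) (hU q hq)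
      have h2 : ∀ (a : U) (b : M), ⟪U.orthogonalProjectionOnto b, a⟫_ℂ = ⟪b, (a : M)⟫_ℂ :=
        fun a b => U.inner_orthogonalProjectionOnto_eq_of_mem_right a b
      rw [h2, h2] at h1
      exact h1)
    (fun y h => Subtype.ext (M.Q.graph_fst_eq_zero_snd h rfl))

/-- The inclusion of the restriction to a reducing subspace. -/
def restrictIncl (M : HilbertOperator.{u}) (U : Submodule ℂ M) [CompleteSpace U]
    (hU : ∀ p ∈ M.Q.graph, (U.starProjection p.1, U.starProjection p.2) ∈ M.Q.graph) :
    M.restrict U hU →ₗᵢ[ℂ] M :=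
  U.subtypeₗᵢ

theorem mem_graph_restrict {U : Submodule ℂ M} [CompleteSpace U]
    {hU : ∀ p ∈ M.Q.graph, (U.starProjection p.1, U.starProjection p.2) ∈ M.Q.graph} {x y : U} :
    ((x, y) : M.restrict U hU × M.restrict U hU) ∈ (M.restrict U hU).Q.graph ↔
      ((x : M), (y : M)) ∈ M.Q.graph :=
  SetLike.ext_iff.1 (graph_ofGraph (M.Q.graph.comap (U.subtype.prodMap U.subtype)) _ _) (x, y)

theorem isKSubstructure_restrictIncl {U : Submodule ℂ M} [CompleteSpace U]
    (hU : ∀ p ∈ M.Q.graph, (U.starProjection p.1, U.starProjection p.2) ∈ M.Q.graph) :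
    IsKSubstructure (M.restrictIncl U hU) :=
  fun _ _ h => mem_graph_restrict.1 h

end HilbertOperator

namespace HilbertOperator

/-! ### Subspaces which are invariant under the functional calculus -/

variable {M M' : HilbertOperator.{u}}

/-- The family of operators is closed under adjoints, so the complement of an invariant subspace is
invariant too. -/
theorem starProjection_borel {D : Submodule ℂ M} [D.HasOrthogonalProjection]
    (hD : ∀ f, ∀ u ∈ D, M.borel f u ∈ D) (f : BoundedBorel) (u : M) :
    D.starProjection (M.borel f u) = M.borel f (D.starProjection u) := by
  refine D.eq_starProjection_of_mem_orthogonal' (z := M.borel f (u - D.starProjection u))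
    (hD f _ (D.starProjection_apply_mem u)) ?_ (by rw [← map_add, add_sub_cancel])
  refine (Submodule.mem_orthogonal _ _).2 fun d hd => ?_
  rw [← inner_borel_star]
  exact (Submodule.mem_orthogonal _ _).1 (D.sub_starProjection_mem_orthogonal u) _ (hD _ d hd)

/-- Membership in the graph is an equation for the resolvent, which belongs to the calculus and
hence commutes with the projection. -/
theorem starProjection_mem_graph {D : Submodule ℂ M} [D.HasOrthogonalProjection]
    (hD : ∀ f, ∀ u ∈ D, M.borel f u ∈ D) {p : M × M} (hp : p ∈ M.Q.graph) :
    (D.starProjection p.1, D.starProjection p.2) ∈ M.Q.graph := by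
  have h := resolvent_apply_of_mem_graph I_im_ne_zero hp
  rw [mem_graph_iff_resolvent I_im_ne_zero]
  rw [← borel_resolventFun] at h ⊢
  rw [← map_smul, ← map_sub, ← starProjection_borel hD, h]

theorem starProjection_orthogonal_mem_graph {D : Submodule ℂ M} [D.HasOrthogonalProjection]
    (hD : ∀ f, ∀ u ∈ D, M.borel f u ∈ D) (p : M × M) (hp : p ∈ M.Q.graph) :
    (Dᗮ.starProjection p.1, Dᗮ.starProjection p.2) ∈ M.Q.graph := by
  rw [Submodule.starProjection_orthogonal_val, Submodule.starProjection_orthogonal_val]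
  exact M.Q.graph.sub_mem hp (starProjection_mem_graph hD hp)

/-! ### The subspace generated by a family -/

variable {ι : Type*}

/-- The linear combinations of the vectors `f(Q) xᵢ`. -/
def combination (x : ι → M) : (ι × BoundedBorel →₀ ℂ) →ₗ[ℂ] M :=
  Finsupp.linearCombination ℂ fun p => M.borel p.2 (x p.1)

@[simp]
theorem combination_single (x : ι → M) (p : ι × BoundedBorel) (c : ℂ) :
    combination x (Finsupp.single p c) = c • M.borel p.2 (x p.1) :=
  Finsupp.linearCombination_single _ _ _

/-- `⟨f(Q)x, g(Q)y⟩ = ⟨x, (f̄g)(Q)y⟩`, so the hypothesis fixes all inner products of the generators.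
-/
theorem inner_combination {x : ι → M} {y : ι → M'}
    (h : ∀ i k f, ⟪x i, M.borel f (x k)⟫_ℂ = ⟪y i, M'.borel f (y k)⟫_ℂ)
    (a b : ι × BoundedBorel →₀ ℂ) :
    ⟪combination x a, combination x b⟫_ℂ = ⟪combination y a, combination y b⟫_ℂ := by
  induction a using Finsupp.induction_linear with
  | zero => simp
  | add a a' ha ha' => rw [map_add, map_add, inner_add_left, inner_add_left, ha, ha']
  | single p c =>
    induction b using Finsupp.induction_linear with
    | zero => simp
    | add b b' hb hb' => rw [map_add, map_add, inner_add_right, inner_add_right, hb, hb']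
    | single q d =>
      simp only [combination_single, inner_smul_left, inner_smul_right, inner_borel_borel, h]

/-- Formal combinations that vanish in `M` also vanish in `M'`, which makes the isometry of the
cyclic subspaces well defined. -/
theorem norm_combination {x : ι → M} {y : ι → M'}
    (h : ∀ i k f, ⟪x i, M.borel f (x k)⟫_ℂ = ⟪y i, M'.borel f (y k)⟫_ℂ)
    (a : ι × BoundedBorel →₀ ℂ) : ‖combination y a‖ = ‖combination x a‖ := by
  rw [@norm_eq_sqrt_re_inner ℂ, @norm_eq_sqrt_re_inner ℂ, inner_combination h]

/-- Multiplication by `f` on formal combinations. -/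
def shift (f : BoundedBorel) : (ι × BoundedBorel →₀ ℂ) →ₗ[ℂ] (ι × BoundedBorel →₀ ℂ) :=
  Finsupp.lmapDomain ℂ ℂ fun p => (p.1, f * p.2)

theorem combination_shift (x : ι → M) (f : BoundedBorel) (a : ι × BoundedBorel →₀ ℂ) :
    combination x (shift f a) = M.borel f (combination x a) := by
  induction a using Finsupp.induction_linear with
  | zero => simp
  | add a a' ha ha' => simp only [map_add, ha, ha']
  | single p c =>
    rw [shift, Finsupp.lmapDomain_apply, Finsupp.mapDomain_single, combination_single,
      combination_single, borel_mul_apply, map_smul]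

/-- The closed linear span of the vectors `f(Q) xᵢ`. -/
def cyclic (x : ι → M) : Submodule ℂ M := (combination x).range.topologicalClosure

instance (x : ι → M) : CompleteSpace (cyclic x) :=
  (Submodule.isClosed_topologicalClosure _).completeSpace_coe

theorem combination_mem_cyclic (x : ι → M) (a : ι × BoundedBorel →₀ ℂ) :
    combination x a ∈ cyclic x :=
  Submodule.le_topologicalClosure _ ⟨a, rfl⟩

theorem self_mem_cyclic (x : ι → M) (i : ι) : x i ∈ cyclic x := by
  have h := combination_mem_cyclic x (Finsupp.single (i, 1) 1)
  rwa [combination_single, borel_one_apply, one_smul] at h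

theorem borel_mem_cyclic (x : ι → M) (f : BoundedBorel) (u : M) (hu : u ∈ cyclic x) :
    M.borel f u ∈ cyclic x := by
  refine map_mem_closure (M.borel f).continuous hu ?_
  rintro _ ⟨a, rfl⟩
  exact ⟨shift f a, combination_shift x f a⟩

/-- The formal combinations as elements of the generated subspace. -/
def toCyclic (x : ι → M) : (ι × BoundedBorel →₀ ℂ) →ₗ[ℂ] cyclic x :=
  (combination x).codRestrict (cyclic x) (combination_mem_cyclic x)

theorem denseRange_toCyclic (x : ι → M) : DenseRange (toCyclic x) := by
  intro u
  rw [closure_subtype]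
  have h : (Subtype.val '' Set.range (toCyclic x)) = ((combination x).range : Set M) := by
    rw [← Set.range_comp]
    rfl
  rw [h]
  exact u.2

theorem extendOfNorm_toCyclic {x : ι → M} {y : ι → M'}
    (h : ∀ i k f, ⟪x i, M.borel f (x k)⟫_ℂ = ⟪y i, M'.borel f (y k)⟫_ℂ)
    (a : ι × BoundedBorel →₀ ℂ) :
    (combination y).extendOfNorm (toCyclic x) (toCyclic x a) = combination y a :=
  LinearMap.extendOfNorm_eq (denseRange_toCyclic x)
    ⟨1, fun a => by rw [one_mul, norm_combination h]; rfl⟩ a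

/-- The isometry between generated subspaces given by equal inner products. -/
def cyclicIsometry {x : ι → M} {y : ι → M'}
    (h : ∀ i k f, ⟪x i, M.borel f (x k)⟫_ℂ = ⟪y i, M'.borel f (y k)⟫_ℂ) : cyclic x →ₗᵢ[ℂ] M' where
  toLinearMap := ((combination y).extendOfNorm (toCyclic x)).toLinearMap
  norm_map' := by
    refine isClosed_property (denseRange_toCyclic x)
      (isClosed_eq (ContinuousLinearMap.continuous _).norm continuous_norm) fun a => ?_
    exact (congrArg norm (extendOfNorm_toCyclic h a)).trans (norm_combination h a)

theorem cyclicIsometry_toCyclic {x : ι → M} {y : ι → M'}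
    (h : ∀ i k f, ⟪x i, M.borel f (x k)⟫_ℂ = ⟪y i, M'.borel f (y k)⟫_ℂ)
    (a : ι × BoundedBorel →₀ ℂ) : cyclicIsometry h (toCyclic x a) = combination y a :=
  extendOfNorm_toCyclic h a

theorem cyclicIsometry_self {x : ι → M} {y : ι → M'}
    (h : ∀ i k f, ⟪x i, M.borel f (x k)⟫_ℂ = ⟪y i, M'.borel f (y k)⟫_ℂ) (i : ι) :
    cyclicIsometry h ⟨x i, self_mem_cyclic x i⟩ = y i := by
  have h1 := cyclicIsometry_toCyclic h (Finsupp.single (i, 1) 1)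
  have h2 : toCyclic x (Finsupp.single (i, 1) 1) = ⟨x i, self_mem_cyclic x i⟩ := by
    apply Subtype.ext
    change combination x _ = x i
    rw [combination_single, borel_one_apply, one_smul]
  rwa [h2, combination_single, borel_one_apply, one_smul] at h1

theorem cyclicIsometry_borel {x : ι → M} {y : ι → M'}
    (h : ∀ i k f, ⟪x i, M.borel f (x k)⟫_ℂ = ⟪y i, M'.borel f (y k)⟫_ℂ) (f : BoundedBorel)
    (u : cyclic x) :
    cyclicIsometry h ⟨M.borel f u, borel_mem_cyclic x f u u.2⟩ =
      M'.borel f (cyclicIsometry h u) := by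
  revert u
  refine isClosed_property (denseRange_toCyclic x) (isClosed_eq ?_ ?_) fun a => ?_
  · exact (cyclicIsometry h).continuous.comp
      (((M.borel f).continuous.comp continuous_subtype_val).subtype_mk _)
  · exact (M'.borel f).continuous.comp (cyclicIsometry h).continuous
  · rw [cyclicIsometry_toCyclic, ← combination_shift, ← cyclicIsometry_toCyclic h]
    congr 1
    exact Subtype.ext (combination_shift x f a).symm

/-! ### The amalgam -/

/-- The part of `M` which is orthogonal to the subspace generated by a family. -/
def cyclicComplement (x : ι → M) : HilbertOperator.{u} :=
  M.restrict (cyclic x)ᗮ (starProjection_orthogonal_mem_graph (borel_mem_cyclic x))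

/-- The inclusion of the orthogonal part. -/
def cyclicComplementIncl (x : ι → M) : cyclicComplement x →ₗᵢ[ℂ] M :=
  M.restrictIncl (cyclic x)ᗮ (starProjection_orthogonal_mem_graph (borel_mem_cyclic x))

theorem isKSubstructure_cyclicComplementIncl (x : ι → M) :
    IsKSubstructure (cyclicComplementIncl x) :=
  isKSubstructure_restrictIncl _

/-- The embedding of `M` in the amalgam of `M'` and `M` along the subspace generated by a family. -/
def amalgamIncl {x : ι → M} {y : ι → M'}
    (h : ∀ i k f, ⟪x i, M.borel f (x k)⟫_ℂ = ⟪y i, M'.borel f (y k)⟫_ℂ) :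
    M →ₗᵢ[ℂ] M'.prod (cyclicComplement x) :=
  prodIsometry (M := M') (M' := cyclicComplement x)
    ((cyclicIsometry h).toLinearMap ∘ₗ (cyclic x).orthogonalProjectionOnto.toLinearMap)
    (cyclic x)ᗮ.orthogonalProjectionOnto.toLinearMap fun u => by
      rw [Submodule.norm_sq_eq_add_norm_sq_starProjection u (cyclic x)]
      refine congrArg₂ (· + ·) (congrArg (· ^ 2) ?_) rfl
      exact (cyclicIsometry h).norm_map _

/-- For the first coordinate, graph membership is again a resolvent equation; the projection to the
cyclic subspace and `cyclicIsometry` both commute with the calculus. -/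
theorem isKSubstructure_amalgamIncl {x : ι → M} {y : ι → M'}
    (h : ∀ i k f, ⟪x i, M.borel f (x k)⟫_ℂ = ⟪y i, M'.borel f (y k)⟫_ℂ) :
    IsKSubstructure (amalgamIncl h) := by
  intro a b hab
  refine mem_graph_prod.2 ⟨?_, mem_graph_restrict.2
    (starProjection_orthogonal_mem_graph (borel_mem_cyclic x) (a, b) hab)⟩
  change (cyclicIsometry h ((cyclic x).orthogonalProjectionOnto a),
    cyclicIsometry h ((cyclic x).orthogonalProjectionOnto b)) ∈ M'.Q.graph
  rw [mem_graph_iff_resolvent I_im_ne_zero, ← map_smul, ← map_sub, ← borel_resolventFun,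
    ← cyclicIsometry_borel]
  congr 1
  apply Subtype.ext
  have h1 := starProjection_borel (borel_mem_cyclic x) (resolventFun I_im_ne_zero)
    (b - Complex.I • a)
  rw [borel_resolventFun, resolvent_apply_of_mem_graph I_im_ne_zero hab] at h1
  refine (DFunLike.congr_fun (M.borel_resolventFun I_im_ne_zero) _).trans (Eq.trans ?_ h1.symm)
  rw [map_sub, map_smul]
  rfl

theorem amalgamIncl_self {x : ι → M} {y : ι → M'}
    (h : ∀ i k f, ⟪x i, M.borel f (x k)⟫_ℂ = ⟪y i, M'.borel f (y k)⟫_ℂ) (i : ι) :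
    amalgamIncl h (x i) = inl M' (cyclicComplement x) (y i) := by
  refine WithLp.ofLp_injective 2 (Prod.ext ?_ ?_)
  · change cyclicIsometry h ((cyclic x).orthogonalProjectionOnto (x i)) = y i
    rw [← cyclicIsometry_self h i]
    congr 1
    exact (cyclic x).orthogonalProjectionOnto_mem_subspace_eq_self ⟨x i, self_mem_cyclic x i⟩
  · exact (cyclic x).orthogonalProjectionOnto_orthogonal_apply_eq_zero (self_mem_cyclic x i)

/-! ### Projections onto a generated substructure -/

variable {j : M →ₗᵢ[ℂ] M'}

theorem IsKSubstructure.generated_image (hj : IsKSubstructure j) {G : Set M}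
    (hG : M.generated G = ⊤) : M'.generated (j '' G) = j.range := by
  have hmem : ∀ (H : HilbertOperator.{u}) (S : Set H) (f : BoundedBorel), ∀ a ∈ S,
      H.borel f a ∈ H.generated S := fun H S f a ha =>
    Submodule.le_topologicalClosure _
      (Submodule.subset_span ⟨a, ha, f, by rw [applyBorel_eq_borel]⟩)
  refine le_antisymm ?_ ?_
  · refine Submodule.topologicalClosure_minimal _ (Submodule.span_le.2 ?_)
      j.isometry.isClosedEmbedding.isClosed_range
    rintro _ ⟨_, ⟨a, -, rfl⟩, f, rfl⟩
    rw [applyBorel_eq_borel, ← hj.map_borel]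
    exact ⟨_, rfl⟩
  · rintro _ ⟨m, rfl⟩
    have h1 : M.generated G ≤ (M'.generated (j '' G)).comap j.toLinearMap := by
      refine Submodule.topologicalClosure_minimal _ (Submodule.span_le.2 ?_)
        ((Submodule.isClosed_topologicalClosure _).preimage j.continuous)
      rintro _ ⟨a, ha, f, rfl⟩
      rw [applyBorel_eq_borel]
      change j (M.borel f a) ∈ M'.generated (j '' G)
      rw [hj.map_borel]
      exact hmem M' _ f _ ⟨a, ha, rfl⟩
    rw [hG] at h1
    exact h1 (Submodule.mem_top (x := m))

/-- When `G` generates `M`, the projection `P_G` is `j` after its adjoint; from here on only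
`retraction j` is needed. -/
theorem IsKSubstructure.proj_eq (hj : IsKSubstructure j) {G : Set M} (hG : M.generated G = ⊤)
    (v : M') : M'.proj (j '' G) v = j (retraction j v) := by
  have hgen := hj.generated_image hG
  refine Submodule.eq_starProjection_of_mem_orthogonal' (z := v - j (retraction j v)) ?_ ?_
    (by rw [add_sub_cancel])
  · rw [hgen]
    exact ⟨_, rfl⟩
  · rw [hgen]
    refine (Submodule.mem_orthogonal _ _).2 ?_
    rintro _ ⟨a, rfl⟩
    change ⟪j a, _⟫_ℂ = 0
    rw [← inner_retraction_right, map_sub, retraction_apply_self, sub_self, inner_zero_right]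

theorem IsKSubstructure.projPerp_eq (hj : IsKSubstructure j) {G : Set M} (hG : M.generated G = ⊤)
    (v : M') : M'.projPerp (j '' G) v = v - j (retraction j v) := by
  rw [← hj.proj_eq hG]
  exact Submodule.starProjection_orthogonal_val v

/-- A Galois type asks for agreement on `G` only; commuting with the calculus extends it to the
whole generated structure. -/
theorem eq_of_eqOn_generators {N : HilbertOperator.{u}} {f g : M →ₗᵢ[ℂ] N} (hf : IsKSubstructure f)
    (hg : IsKSubstructure g) {G : Set M} (hG : M.generated G = ⊤) (h : ∀ a ∈ G, f a = g a) (m : M) :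
    f m = g m := by
  have h1 : M.generated G ≤ LinearMap.eqLocus f.toLinearMap g.toLinearMap := by
    refine Submodule.topologicalClosure_minimal _ (Submodule.span_le.2 ?_)
      (isClosed_eq f.continuous g.continuous)
    rintro _ ⟨a, ha, b, rfl⟩
    rw [applyBorel_eq_borel]
    change f (M.borel b a) = g (M.borel b a)
    rw [hf.map_borel, hg.map_borel, h a ha]
  rw [hG] at h1
  exact h1 (Submodule.mem_top (x := m))

/-! ### Inner products of a vector and its parameters -/

/-- The parameters together with a further vector. -/
def withParameters (j : M →ₗᵢ[ℂ] M') (v : M') : Option M → M'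
  | none => v
  | some a => j a

theorem inner_map_borel (hj : IsKSubstructure j) (a : M) (f : BoundedBorel) (v : M') :
    ⟪j a, M'.borel f v⟫_ℂ = ⟪a, M.borel f (retraction j v)⟫_ℂ := by
  rw [← inner_borel_star, ← hj.map_borel, ← inner_retraction_right, inner_borel_star]

theorem inner_borel_map (hj : IsKSubstructure j) (a : M) (f : BoundedBorel) (v : M') :
    ⟪v, M'.borel f (j a)⟫_ℂ = ⟪retraction j v, M.borel f a⟫_ℂ := by
  rw [← hj.map_borel, ← inner_conj_symm, ← inner_retraction_right, inner_conj_symm]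

/-- The image of `j` is invariant under the calculus, so the cross terms between the two components
of `v` vanish. -/
theorem inner_borel_self (hj : IsKSubstructure j) (f : BoundedBorel) (v : M') :
    ⟪v, M'.borel f v⟫_ℂ = ⟪retraction j v, M.borel f (retraction j v)⟫_ℂ +
      ∫ x, (f : ℝ → ℂ) x ∂(M'.spectralMeasure (v - j (retraction j v))) := by
  have h0 : retraction j (v - j (retraction j v)) = 0 := by
    rw [map_sub, retraction_apply_self, sub_self]
  rw [← inner_borel_eq_integral, map_sub, inner_sub_right, inner_borel_map hj, h0, inner_zero_left,
    sub_zero, inner_sub_left, inner_map_borel hj, add_sub_cancel]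

theorem inner_withParameters {M₀ M₁ M₂ : HilbertOperator.{u}} {j₁ : M₀ →ₗᵢ[ℂ] M₁}
    {j₂ : M₀ →ₗᵢ[ℂ] M₂} (hj₁ : IsKSubstructure j₁) (hj₂ : IsKSubstructure j₂) {v : M₁} {w : M₂}
    (hp : retraction j₁ v = retraction j₂ w)
    (hμ : M₁.spectralMeasure (v - j₁ (retraction j₁ v)) =
      M₂.spectralMeasure (w - j₂ (retraction j₂ w))) (a b : Option M₀) (f : BoundedBorel) :
    ⟪withParameters j₂ w a, M₂.borel f (withParameters j₂ w b)⟫_ℂ =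
      ⟪withParameters j₁ v a, M₁.borel f (withParameters j₁ v b)⟫_ℂ := by
  match a, b with
  | none, none =>
    simp only [withParameters]
    rw [inner_borel_self hj₁, inner_borel_self hj₂, hμ, hp]
  | none, some b =>
    simp only [withParameters]
    rw [inner_borel_map hj₁, inner_borel_map hj₂, hp]
  | some a, none =>
    simp only [withParameters]
    rw [inner_map_borel hj₁, inner_map_borel hj₂, hp]
  | some a, some b =>
    simp only [withParameters]
    rw [inner_map_borel hj₁, inner_map_borel hj₂, retraction_apply_self, retraction_apply_self]

end HilbertOperator

end
-- The characterization of Galois types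
/-- The structure `M₀` with its embeddings `j₁`, `j₂` is the common substructure `(H_G, Γ_{Q_G})` of
`M₁` and `M₂`; the projections `P_G v` and `P_G w` are equal when they are the images of the same
vector of `M₀`. -/
theorem mainTheorem2 (H M₀ M₁ M₂ : HilbertOperator.{u})
    (h₀ : M₀ ∈ H.structureClass) (h₁ : M₁ ∈ H.structureClass) (h₂ : M₂ ∈ H.structureClass)
    (j₁ : M₀ →ₗᵢ[ℂ] M₁) (j₂ : M₀ →ₗᵢ[ℂ] M₂)
    (hj₁ : HilbertOperator.IsKSubstructure j₁) (hj₂ : HilbertOperator.IsKSubstructure j₂)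
    (G : Set M₀) (hG : M₀.generated G = ⊤) (v : M₁) (w : M₂) :
    HilbertOperator.SameGaloisType H M₁ M₂ (fun a : G => j₁ a) (fun a : G => j₂ a) v w ↔
      (∃ p : M₀, M₁.proj (j₁ '' G) v = j₁ p ∧ M₂.proj (j₂ '' G) w = j₂ p) ∧
      M₁.spectralMeasure (M₁.projPerp (j₁ '' G) v) =
        M₂.spectralMeasure (M₂.projPerp (j₂ '' G) w) := by
  rw [hj₁.proj_eq hG, hj₂.proj_eq hG, hj₁.projPerp_eq hG, hj₂.projPerp_eq hG]
  constructor
  · rintro ⟨N, -, f, g, hf, hg, hvw, hfg⟩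
    have hm : ∀ m, f (j₁ m) = g (j₂ m) := fun m =>
      HilbertOperator.eq_of_eqOn_generators (hf.2.comp hj₁) (hg.2.comp hj₂) hG
        (fun a ha => hfg ⟨a, ha⟩) m
    have hp : HilbertOperator.retraction j₁ v = HilbertOperator.retraction j₂ w := by
      refine ext_inner_left ℂ fun a => ?_
      rw [HilbertOperator.inner_retraction_right, HilbertOperator.inner_retraction_right,
        ← f.inner_map_map, ← g.inner_map_map, hvw, hm]
    refine ⟨⟨_, rfl, by rw [hp]⟩, ?_⟩
    -- Both orthogonal remainders have the same image in `N`, and embeddings preserve spectral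
    -- measures.
    rw [← hf.2.spectralMeasure_map, ← hg.2.spectralMeasure_map, map_sub, map_sub, hvw, hm, hp]
  · rintro ⟨⟨p, hp₁, hp₂⟩, hμ⟩
    have hp : HilbertOperator.retraction j₁ v = HilbertOperator.retraction j₂ w :=
      (j₁.injective hp₁).trans (j₂.injective hp₂).symm
    have hx := HilbertOperator.inner_withParameters hj₁ hj₂ hp hμ
    -- The family contains all of `M₀` and not only `G`, so that the complement is visibly
    -- orthogonal to `j₂ M₀`, as membership in the class requires.
    let x := HilbertOperator.withParameters j₂ w
    refine ⟨M₁.prod (HilbertOperator.cyclicComplement x), ?_, HilbertOperator.inl _ _,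
      HilbertOperator.amalgamIncl hx, (HilbertOperator.isKSubstructure_inl _ _).isKEmbedding,
      (HilbertOperator.isKSubstructure_amalgamIncl hx).isKEmbedding,
      (HilbertOperator.amalgamIncl_self hx none).symm,
      fun a => (HilbertOperator.amalgamIncl_self hx (some a)).symm⟩
    refine HilbertOperator.mem_structureClass_of_sum h₀ h₁ h₂ hj₂
      (HilbertOperator.isKSubstructure_cyclicComplementIncl x) (fun r a => ?_)
      (HilbertOperator.isKSubstructure_inl _ _) (HilbertOperator.isKSubstructure_inr _ _)
      (HilbertOperator.inl_add_inr _ _)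
    exact (Submodule.mem_orthogonal' _ _).1 r.2 _ (HilbertOperator.self_mem_cyclic x (some a))
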